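/- Let $n\ge 1$. Let $e_1,\dots,e_{2n}$ be the standard basis of $\mathbb R^{2n}$ and let $$V=\Big\{v\in\mathbb R^{2n}\ :\ \sum_{i=1}^n(-1)^iv_{2i}=0,\ \sum_{i=1}^n(-1)^iv_{2i-1}=0\Big\},$$ with basis $v_i=e_i+e_{i+2}$, $1\le i\le 2n-2$. Let $\Lambda_{2n-2}$ be the skew-symmetric bilinear form on $V$ with $\Lambda_{2n-2}(v_i,v_{i+1})=(-1)^{i+1}$ for $1\le i\le 2n-3$ and $\Lambda_{2n-2}(v_i,v_j)=0$ for $j>i+1$. For a non-crossing partition $\sigma$ of $\{\bar 1,\dots,\bar n\}$, let $\tilde\sigma$ be its dual non-crossing partition of $\{\tilde 1,\dots,\tilde n\}$, where the $2n$ points lie on a circle in the order $\bar 1,\tilde 1,\bar 2,\tilde 2,\dots,\bar n,\tilde n$: two points $\tilde i,\tilde j$ are in one part of $\tilde\sigma$ if and only if the chord joining them separates no two points of the same part of $\sigma$. Identify $(\bar 1,\tilde 1,\dots,\bar n,\tilde n)$ with $(1,2,\dots,2n)$. A subset $I\subset\{1,\dots,2n\}$ with $n-1$ elements is concordant with $\sigma$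 if each part of $\sigma$ and each part of $\tilde\sigma$ contains exactly one element not in $I$. For $I=\{i_1<\dots<i_{n-1}\}$ put $e_I=e_{i_1}\wedge\dots\wedge e_{i_{n-1}}$, and let $w_\sigma=\sum_I e_I$, the sum being over all $I$ concordant with $\sigma$. The concordance space $H\subset\bigwedge^{n-1}\mathbb R^{2n}$ is the span of the vectors $w_\sigma$ over all non-crossing partitions $\sigma$ of $\{\bar 1,\dots,\bar n\}$. For a skew-symmetric bilinear form $\omega$ on $V$ let $Q_\omega:\bigwedge^{k}V\to\bigwedge^{k-2}V$ be the linear map $$Q_\omega(x_1\wedge\dots\wedge x_k)=\sum_{i<j}(-1)^{i+j-1}\omega(x_i,x_j)\,x_1\wedge\dots\wedge\widehat{x_i}\wedge\dots\wedge\widehat{x_j}\wedge\dots\wedge x_k$$ (so $Q_\omega=0$ if $k<2$), and regard $\bigwedge^{n-1}V$ as a subspace of $\bigwedge^{n-1}\mathbb R^{2n}$. **Theorem.** Let $\omega$ be a skew-symmetric bilinear form on $V$ such that the kernel of $Q_\omega$ on $\bigwedge^{n-1}V$ is equal to $H$; if $n=2$, assume moreover that $\omega\ne 0$. Then $\omega=a\cdot\Lambda_{2n-2}$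 for some $a\in\mathbb R\setminus\{0\}$. -/

import Mathlib

open scoped BigOperators

noncomputable section

namespace Concordance

/-! ### The convolution with a skew-symmetric form -/

section Convolution

variable {W : Type*} [AddCommGroup W] [Module ℝ W]

/-- Skew-symmetry of a bilinear form: `ω(x, y) = -ω(y, x)`. -/
def IsSkewSymmetric (ω : LinearMap.BilinForm ℝ W) : Prop :=
  ∀ x y, ω x y = -ω y x

theorem IsSkewSymmetric.self_eq_zero {ω : LinearMap.BilinForm ℝ W} (h : IsSkewSymmetric ω)
    (x : W) : ω x x = 0 := by
  have := h x x
  linarith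

/-- The expression
`∑_{i<j} (-1)^{i+j-1} ω(x_i, x_j) x_1 ∧ ⋯ ∧ x̂_i ∧ ⋯ ∧ x̂_j ∧ ⋯ ∧ x_{k+2}` (positions counted from
`1`). In the code positions are counted from `0`, so that the sign is `(-1)^{i+j+1}`; the entry at
position `j` is deleted first, and then the one at position `i < j`. -/
def convolutionFun (ω : LinearMap.BilinForm ℝ W) (k : ℕ) (x : Fin (k + 2) → W) : ⋀[ℝ]^k W :=
  ∑ j : Fin (k + 2), ∑ i : Fin (k + 1),
    if i.castSucc < j then
      ((-1 : ℝ) ^ ((i : ℕ) + (j : ℕ) + 1) * ω (x i.castSucc) (x j)) •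
        exteriorPower.ιMulti ℝ k (fun t => x (j.succAbove (i.succAbove t)))
    else 0

/-- Auxiliary operator on the whole exterior algebra, used only to see that `convolutionFun` is
multilinear and alternating: `C (x ∧ y) = ω(x, ·)⌋y + x ∧ C y`. -/
def convolutionAux (ω : LinearMap.BilinForm ℝ W) (hω : IsSkewSymmetric ω) :
    ExteriorAlgebra ℝ W →ₗ[ℝ] ExteriorAlgebra ℝ W :=
  CliffordAlgebra.foldr' (0 : QuadraticForm ℝ W)
    (LinearMap.mk₂ ℝ
      (fun (m : W) (p : CliffordAlgebra (0 : QuadraticForm ℝ W) × ExteriorAlgebra ℝ W) =>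
        (CliffordAlgebra.contractLeft (ω m) p.1 + ExteriorAlgebra.ι ℝ m * p.2 :
          ExteriorAlgebra ℝ W))
      (by intro a b p; simp only [map_add, LinearMap.add_apply, add_mul]; abel)
      (by intro c a p; simp only [map_smul, LinearMap.smul_apply, smul_add, smul_mul_assoc])
      (by intro a p q; simp only [Prod.fst_add, Prod.snd_add, map_add, mul_add]; abel)
      (by intro c a p; simp only [Prod.smul_fst, Prod.smul_snd, map_smul, smul_add,
            mul_smul_comm]))
    (by
      intro m x fx
      simp only [LinearMap.mk₂_apply, zero_apply, zero_smul]
      rw [CliffordAlgebra.contractLeft_ι_mul, hω.self_eq_zero, mul_add, ← mul_assoc]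
      erw [ExteriorAlgebra.ι_sq_zero]
      simp only [zero_smul, zero_mul, add_zero, zero_sub]
      exact neg_add_cancel _)
    0

theorem convolutionAux_ι_mul (ω : LinearMap.BilinForm ℝ W) (hω : IsSkewSymmetric ω) (m : W)
    (y : ExteriorAlgebra ℝ W) :
    convolutionAux ω hω (ExteriorAlgebra.ι ℝ m * y) =
      (CliffordAlgebra.contractLeft (ω m) y + ExteriorAlgebra.ι ℝ m * convolutionAux ω hω y :
        ExteriorAlgebra ℝ W) := by
  unfold convolutionAux
  exact CliffordAlgebra.foldr'_ι_mul _ _ _ _ _ _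

theorem convolutionAux_one (ω : LinearMap.BilinForm ℝ W) (hω : IsSkewSymmetric ω) :
    convolutionAux ω hω 1 = 0 := by
  unfold convolutionAux
  have := CliffordAlgebra.foldr'_algebraMap (0 : QuadraticForm ℝ W) (N := ExteriorAlgebra ℝ W)
  rw [← map_one (algebraMap ℝ (ExteriorAlgebra ℝ W))]
  erw [this]
  simp

theorem contractLeft_ι_mul_exterior (d : Module.Dual ℝ W) (a : W) (y : ExteriorAlgebra ℝ W) :
    (CliffordAlgebra.contractLeft d (ExteriorAlgebra.ι ℝ a * y) : ExteriorAlgebra ℝ W) =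
      (d a • y - ExteriorAlgebra.ι ℝ a * CliffordAlgebra.contractLeft d y :
        ExteriorAlgebra ℝ W) :=
  CliffordAlgebra.contractLeft_ι_mul d a y

theorem contractLeft_ιMulti (d : Module.Dual ℝ W) (m : ℕ) (y : Fin (m + 1) → W) :
    (CliffordAlgebra.contractLeft d (ExteriorAlgebra.ιMulti ℝ (m + 1) y) : ExteriorAlgebra ℝ W) =
      ∑ j : Fin (m + 1), ((-1 : ℝ) ^ (j : ℕ) * d (y j)) •
        ExteriorAlgebra.ιMulti ℝ m (fun t => y (j.succAbove t)) := by
  induction m with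
  | zero =>
    rw [ExteriorAlgebra.ιMulti_succ_apply, contractLeft_ι_mul_exterior,
      ExteriorAlgebra.ιMulti_zero_apply]
    have h : (CliffordAlgebra.contractLeft d (1 : ExteriorAlgebra ℝ W) : ExteriorAlgebra ℝ W) = 0 :=
      CliffordAlgebra.contractLeft_one 0 d
    rw [h]
    simp
  | succ m ih =>
    rw [ExteriorAlgebra.ιMulti_succ_apply, contractLeft_ι_mul_exterior, ih, Fin.sum_univ_succ (n := m + 1),
      Finset.mul_sum, sub_eq_add_neg, ← Finset.sum_neg_distrib]
    congr 1
    · simp only [Fin.val_zero, pow_zero, one_mul, Fin.zero_succAbove]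
      rfl
    · refine Finset.sum_congr rfl fun j _ => ?_
      rw [ExteriorAlgebra.ιMulti_succ_apply, mul_smul_comm, ← neg_smul]
      simp only [Fin.succ_succAbove_zero, Fin.val_succ, Matrix.vecTail, Function.comp_def,
        Fin.succ_succAbove_succ]
      congr 1
      ring

theorem coe_convolutionFun (ω : LinearMap.BilinForm ℝ W) (hω : IsSkewSymmetric ω) (k : ℕ)
    (x : Fin (k + 2) → W) :
    (convolutionFun ω k x : ExteriorAlgebra ℝ W) =
      convolutionAux ω hω (ExteriorAlgebra.ιMulti ℝ (k + 2) x) := by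
  have key : ∀ (k : ℕ) (x : Fin (k + 2) → W),
      (convolutionFun ω k x : ExteriorAlgebra ℝ W) =
      ∑ j : Fin (k + 2), ∑ i : Fin (k + 1),
        if i.castSucc < j then
          ((-1 : ℝ) ^ ((i : ℕ) + (j : ℕ) + 1) * ω (x i.castSucc) (x j)) •
            ExteriorAlgebra.ιMulti ℝ k (fun t => x (j.succAbove (i.succAbove t)))
        else 0 := by
    intro k x
    unfold convolutionFun
    simp only [Submodule.coe_sum]
    refine Finset.sum_congr rfl fun j _ => Finset.sum_congr rfl fun i _ => ?_
    split_ifs <;> rfl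
  rw [key]
  induction k with
  | zero =>
    rw [ExteriorAlgebra.ιMulti_succ_apply, convolutionAux_ι_mul, contractLeft_ιMulti,
      ExteriorAlgebra.ιMulti_succ_apply, ExteriorAlgebra.ιMulti_zero_apply,
      convolutionAux_ι_mul, convolutionAux_one]
    erw [CliffordAlgebra.contractLeft_one]
    simp [Fin.sum_univ_succ, Matrix.vecTail]
  | succ k ih =>
    rw [ExteriorAlgebra.ιMulti_succ_apply, convolutionAux_ι_mul, contractLeft_ιMulti, ← ih,
      Fin.sum_univ_succ]
    simp only [Fin.not_lt_zero, if_false, Finset.sum_const_zero, zero_add]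
    rw [Finset.mul_sum, ← Finset.sum_add_distrib]
    refine Finset.sum_congr rfl fun j _ => ?_
    rw [Fin.sum_univ_succ, Finset.mul_sum]
    congr 1
    · simp [Matrix.vecTail, Function.comp_def, pow_add]
    · refine Finset.sum_congr rfl fun i _ => ?_
      have h : (i.succ.castSucc < j.succ) ↔ i.castSucc < j := by
        simp [Fin.lt_def]
      simp only [h]
      split_ifs
      · rw [ExteriorAlgebra.ιMulti_succ_apply, mul_smul_comm]
        simp only [Fin.succ_succAbove_zero, Fin.val_succ, Matrix.vecTail, Function.comp_def,
          Fin.succ_succAbove_succ, Fin.castSucc_succ]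
        congr 1
        ring
      · simp

/-- `convolutionFun` as an alternating map of `k + 2` vectors. -/
def convolutionAlternating (ω : LinearMap.BilinForm ℝ W) (hω : IsSkewSymmetric ω) (k : ℕ) :
    W [⋀^Fin (k + 2)]→ₗ[ℝ] ⋀[ℝ]^k W where
  toFun := convolutionFun ω k
  map_update_add' x i a b := by
    apply Subtype.ext
    simp only [Submodule.coe_add, coe_convolutionFun ω hω, AlternatingMap.map_update_add, map_add]
  map_update_smul' x i c a := by
    apply Subtype.ext
    simp only [Submodule.coe_smul, coe_convolutionFun ω hω, AlternatingMap.map_update_smul,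
      map_smul]
  map_eq_zero_of_eq' x i j h hij := by
    apply Subtype.ext
    rw [coe_convolutionFun ω hω, AlternatingMap.map_eq_zero_of_eq _ x h hij, map_zero]
    rfl

/-- The convolution operator `Q : ⋀^k W → ⋀^{k-2} W` of a skew-symmetric form `ω`, the linear map
determined by
`Q(x_1 ∧ ⋯ ∧ x_k) = ∑_{i<j} (-1)^{i+j-1} ω(x_i, x_j) x_1 ∧ ⋯ ∧ x̂_i ∧ ⋯ ∧ x̂_j ∧ ⋯ ∧ x_k`.
For `k < 2` the sum is empty and `Q = 0`. -/
def convolution (ω : LinearMap.BilinForm ℝ W) (hω : IsSkewSymmetric ω) :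
    (k : ℕ) → (⋀[ℝ]^k W →ₗ[ℝ] ⋀[ℝ]^(k - 2) W)
  | 0 => 0
  | 1 => 0
  | k + 2 => exteriorPower.alternatingMapLinearEquiv (convolutionAlternating ω hω k)

theorem convolution_ιMulti (ω : LinearMap.BilinForm ℝ W) (hω : IsSkewSymmetric ω) (k : ℕ)
    (x : Fin (k + 2) → W) :
    convolution ω hω (k + 2) (exteriorPower.ιMulti ℝ (k + 2) x) =
      ∑ j : Fin (k + 2), ∑ i : Fin (k + 1),
        if i.castSucc < j then
          ((-1 : ℝ) ^ ((i : ℕ) + (j : ℕ) + 1) * ω (x i.castSucc) (x j)) •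
            exteriorPower.ιMulti ℝ k (fun t => x (j.succAbove (i.succAbove t)))
        else 0 :=
  exteriorPower.alternatingMapLinearEquiv_apply_ιMulti _ _

end Convolution

/-! ### Non-crossing partitions, duals, and concordance

The vertices `1̄, …, n̄` and `1̃, …, ñ` are both indexed by `Fin n` (so `i : Fin n` stands for the
vertex with number `i + 1`), and `{1̄, 1̃, 2̄, 2̃, …, n̄, ñ}` is identified with `{1, …, 2n}`, which
is indexed by `Fin (2 * n)`. A set partition is a `Setoid`, its parts are `Setoid.classes`. -/

/-- The position of the vertex `ī` on the circle with `2n` vertices. -/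
def bar {n : ℕ} (i : Fin n) : Fin (2 * n) := ⟨2 * (i : ℕ), by omega⟩

/-- The position of the vertex `ĩ` on the circle with `2n` vertices: next after `ī`. -/
def tilde {n : ℕ} (i : Fin n) : Fin (2 * n) := ⟨2 * (i : ℕ) + 1, by omega⟩

theorem bar_val {n : ℕ} (i : Fin n) : (bar i : ℕ) = 2 * (i : ℕ) := rfl

theorem tilde_val {n : ℕ} (i : Fin n) : (tilde i : ℕ) = 2 * (i : ℕ) + 1 := rfl

/-- No `i < j < k < l` have `i, k` in one part and `j, l` in a different one. -/
def IsNonCrossing {n : ℕ} (σ : Setoid (Fin n)) : Prop :=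
  ∀ i j k l : Fin n, i < j → j < k → k < l → σ i k → σ j l → σ i j

/-- The dual partition of `{1̃, …, ñ}`: `ĩ` and `j̃` are in one part if and only if the chord from
`ĩ` to `j̃` separates no two vertices of the same part of `σ`. Here `a ≤ i` says that `ā` comes
before `ĩ`, so the chord has on one side the `ā` for which `a ≤ i` and `a ≤ j` are
equivalent, and on the other side the remaining ones. -/
def dual {n : ℕ} (σ : Setoid (Fin n)) : Setoid (Fin n) where
  r i j := ∀ a b : Fin n, σ a b → ((a ≤ i ↔ a ≤ j) ↔ (b ≤ i ↔ b ≤ j))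
  iseqv :=
    { refl := fun i a b _ => by tauto
      symm := fun h a b hab => by have := h a b hab; tauto
      trans := fun h₁ h₂ a b hab => by have := h₁ a b hab; have := h₂ a b hab; tauto }

/-- `I ⊆ {1, …, 2n}` is concordant with `σ`: it has `n - 1` elements, and each part of `σ` and each
part of the dual of `σ` contains exactly one element not in `I`. -/
def IsConcordant {n : ℕ} (σ : Setoid (Fin n)) (I : Finset (Fin (2 * n))) : Prop :=
  I.card = n - 1 ∧
    (∀ B ∈ σ.classes, ∃! i, i ∈ B ∧ bar i ∉ I) ∧
    (∀ B ∈ (dual σ).classes, ∃! i, i ∈ B ∧ tilde i ∉ I)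

/-- `e_I = e_{i_1} ∧ ⋯ ∧ e_{i_{n-1}}` for `I = {i_1 < ⋯ < i_{n-1}} ⊆ {1, …, 2n}`. -/
def eWedge (n : ℕ) (I : Set.powersetCard (Fin (2 * n)) (n - 1)) :
    ⋀[ℝ]^(n - 1) (Fin (2 * n) → ℝ) :=
  exteriorPower.ιMulti_family ℝ (n - 1) (Pi.basisFun ℝ (Fin (2 * n))) I

open Classical in
/-- The concordance vector `w_σ`, the sum of the `e_I` over all `I` concordant with `σ`. -/
def concordanceVector {n : ℕ} (σ : Setoid (Fin n)) : ⋀[ℝ]^(n - 1) (Fin (2 * n) → ℝ) :=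
  ∑ I : Set.powersetCard (Fin (2 * n)) (n - 1),
    (if IsConcordant σ (I : Finset (Fin (2 * n))) then (1 : ℝ) else 0) • eWedge n I

/-- The concordance space `H`, spanned by the `w_σ` for all non-crossing partitions `σ`. -/
def concordanceSpace (n : ℕ) : Submodule ℝ (⋀[ℝ]^(n - 1) (Fin (2 * n) → ℝ)) :=
  Submodule.span ℝ {w | ∃ σ : Setoid (Fin n), IsNonCrossing σ ∧ w = concordanceVector σ}

/-! ### The space `V` and the form `Λ` -/

/-- `V = {v ∈ ℝ^{2n} | ∑_{i=1}^n (-1)^i v_{2i} = 0, ∑_{i=1}^n (-1)^i v_{2i-1} = 0}`. -/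
def V (n : ℕ) : Submodule ℝ (Fin (2 * n) → ℝ) where
  carrier := {v | ∑ i : Fin n, (-1 : ℝ) ^ ((i : ℕ) + 1) * v (tilde i) = 0 ∧
    ∑ i : Fin n, (-1 : ℝ) ^ ((i : ℕ) + 1) * v (bar i) = 0}
  add_mem' := by
    rintro a b ⟨ha, ha'⟩ ⟨hb, hb'⟩
    simp only [Set.mem_ofPred_eq, Pi.add_apply, mul_add, Finset.sum_add_distrib, ha, ha', hb, hb',
      add_zero, and_self]
  zero_mem' := by simp
  smul_mem' := by
    rintro c a ⟨ha, ha'⟩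
    simp only [Set.mem_ofPred_eq, Pi.smul_apply, smul_eq_mul, mul_left_comm _ c, ← Finset.mul_sum,
      ha, ha', mul_zero, and_self]

/-- The vector of `ℝ^{2n}` with entries `1` at the positions `i` and `i + 2`, and `0` elsewhere. -/
def vVec (n : ℕ) (i : Fin (2 * n - 2)) : Fin (2 * n) → ℝ :=
  fun k => if (k : ℕ) = i ∨ (k : ℕ) = i + 2 then 1 else 0

theorem vVec_mem (n : ℕ) (i : Fin (2 * n - 2)) : vVec n i ∈ V n := by
  have hi := i.2
  have key : ∀ m : ℕ, m + 1 < n →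
      ∑ k : Fin n, (-1 : ℝ) ^ ((k : ℕ) + 1) *
        (if (k : ℕ) = m ∨ (k : ℕ) = m + 1 then (1 : ℝ) else 0) = 0 := by
    intro m hm
    have : ∀ k : Fin n, (-1 : ℝ) ^ ((k : ℕ) + 1) *
        (if (k : ℕ) = m ∨ (k : ℕ) = m + 1 then (1 : ℝ) else 0) =
        (if k = ⟨m, by omega⟩ then (-1 : ℝ) ^ (m + 1) else 0) +
        (if k = ⟨m + 1, hm⟩ then (-1 : ℝ) ^ (m + 1 + 1) else 0) := by
      intro k
      simp only [Fin.ext_iff]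
      by_cases h1 : (k : ℕ) = m
      · simp [h1]
      · by_cases h2 : (k : ℕ) = m + 1
        · simp [h2]
        · simp [h1, h2]
    rw [Finset.sum_congr rfl fun k _ => this k, Finset.sum_add_distrib]
    simp [pow_succ]
  rcases Nat.even_or_odd' (i : ℕ) with ⟨m, hm | hm⟩ <;> have hmn : m + 1 < n := by omega
  · refine ⟨?_, ?_⟩
    · refine Finset.sum_eq_zero fun k _ => ?_
      rw [vVec, if_neg (by rw [tilde_val]; omega), mul_zero]
    · rw [← key m hmn]
      refine Finset.sum_congr rfl fun k _ => ?_
      rw [vVec]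
      congr 1
      exact if_congr (by rw [bar_val]; omega) rfl rfl
  · refine ⟨?_, ?_⟩
    · rw [← key m hmn]
      refine Finset.sum_congr rfl fun k _ => ?_
      rw [vVec]
      congr 1
      exact if_congr (by rw [tilde_val]; omega) rfl rfl
    · refine Finset.sum_eq_zero fun k _ => ?_
      rw [vVec, if_neg (by rw [bar_val]; omega), mul_zero]

theorem vVec_linearIndependent (n : ℕ) :
    LinearIndependent ℝ (fun i : Fin (2 * n - 2) => (⟨vVec n i, vVec_mem n i⟩ : V n)) := by
  rw [Fintype.linearIndependent_iff]
  intro c hc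
  have hc' : ∀ k : Fin (2 * n), ∑ j, c j * vVec n j k = 0 := by
    intro k
    have := congrFun (congrArg Subtype.val hc) k
    simpa using this
  have main : ∀ m : ℕ, ∀ i : Fin (2 * n - 2), (i : ℕ) = m → c i = 0 := by
    intro m
    induction m using Nat.strong_induction_on with
    | _ m ih =>
      intro i him
      have h := hc' ⟨i, by omega⟩
      rw [Finset.sum_eq_single i] at h
      · simpa [vVec] using h
      · intro j _ hj
        have hj' : (j : ℕ) ≠ i := fun e => hj (Fin.ext e)
        by_cases h2 : (i : ℕ) = j + 2
        · rw [ih j (by omega) j rfl, zero_mul]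
        · simp only [vVec]
          rw [if_neg (by omega), mul_zero]
      · simp
  exact fun i => main _ i rfl

theorem finrank_V (n : ℕ) : Module.finrank ℝ (V n) = 2 * n - 2 := by
  apply le_antisymm
  · rcases Nat.eq_zero_or_pos n with rfl | hn
    · simpa using Submodule.finrank_le (V 0)
    · let φ : (Fin (2 * n) → ℝ) →ₗ[ℝ] ℝ × ℝ :=
        LinearMap.prod
          (∑ i : Fin n, (-1 : ℝ) ^ ((i : ℕ) + 1) • LinearMap.proj (tilde i))
          (∑ i : Fin n, (-1 : ℝ) ^ ((i : ℕ) + 1) • LinearMap.proj (bar i))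
      have hφv : ∀ v, φ v = (∑ i : Fin n, (-1 : ℝ) ^ ((i : ℕ) + 1) * v (tilde i),
          ∑ i : Fin n, (-1 : ℝ) ^ ((i : ℕ) + 1) * v (bar i)) := by
        intro v
        refine Prod.ext ?_ ?_
        · change (∑ i : Fin n, (-1 : ℝ) ^ ((i : ℕ) + 1) • LinearMap.proj (tilde i) :
            (Fin (2 * n) → ℝ) →ₗ[ℝ] ℝ) v = _
          rw [LinearMap.sum_apply]
          rfl
        · change (∑ i : Fin n, (-1 : ℝ) ^ ((i : ℕ) + 1) • LinearMap.proj (bar i) :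
            (Fin (2 * n) → ℝ) →ₗ[ℝ] ℝ) v = _
          rw [LinearMap.sum_apply]
          rfl
      have hφ : Function.Surjective φ := by
        rintro ⟨s, t⟩
        refine ⟨fun k => if (k : ℕ) = 0 then -t else if (k : ℕ) = 1 then -s else 0, ?_⟩
        rw [hφv]
        refine Prod.ext ?_ ?_
        · simp only [tilde_val]
          rw [Finset.sum_eq_single (⟨0, hn⟩ : Fin n)]
          · simp
          · intro b _ hb
            have : (b : ℕ) ≠ 0 := fun e => hb (Fin.ext e)
            simp [this]
          · simp
        · simp only [bar_val]
          rw [Finset.sum_eq_single (⟨0, hn⟩ : Fin n)]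
          · simp
          · intro b _ hb
            have : (b : ℕ) ≠ 0 := fun e => hb (Fin.ext e)
            have h2 : 2 * (b : ℕ) ≠ 1 := by omega
            simp [this, h2]
          · simp
      have hV : V n = LinearMap.ker φ := by
        ext v
        rw [LinearMap.mem_ker, hφv, Prod.mk_eq_zero]
        rfl
      have h1 := LinearMap.finrank_range_add_finrank_ker φ
      rw [LinearMap.range_eq_top.mpr hφ, finrank_top] at h1
      simp only [Module.finrank_prod, Module.finrank_self, Module.finrank_fintype_fun_eq_card,
        Fintype.card_fin] at h1
      rw [hV]
      omega
  · simpa using (vVec_linearIndependent n).fintype_card_le_finrank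

/-- The basis `v_1 = (1,0,1,0,…,0), v_2 = (0,1,0,1,0,…,0), …, v_{2n-2} = (0,…,0,1,0,1)` of `V`. -/
def vBasis (n : ℕ) : Module.Basis (Fin (2 * n - 2)) ℝ (V n) :=
  Module.Basis.mk (vVec_linearIndependent n) (by
    rw [(vVec_linearIndependent n).span_eq_top_of_card_eq_finrank' (by
      rw [finrank_V, Fintype.card_fin])])

theorem coe_vBasis (n : ℕ) (i : Fin (2 * n - 2)) : (vBasis n i : Fin (2 * n) → ℝ) = vVec n i := by
  simp [vBasis]

/-- The tridiagonal skew-symmetric matrix with zero diagonal and with superdiagonal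
`1, -1, 1, -1, …, 1` . -/
def lambdaMatrix (n : ℕ) : Matrix (Fin (2 * n - 2)) (Fin (2 * n - 2)) ℝ :=
  Matrix.of fun i j =>
    if (j : ℕ) = i + 1 then (-1) ^ (i : ℕ)
    else if (i : ℕ) = j + 1 then -(-1) ^ (j : ℕ)
    else 0

/-- The form `Λ_{2n-2}` on `V`, given by `lambdaMatrix` in the basis `v_1, …, v_{2n-2}`. -/
def lambdaForm (n : ℕ) : LinearMap.BilinForm ℝ (V n) :=
  Matrix.toBilin (vBasis n) (lambdaMatrix n)

end Concordance

end

/-! The convolution satisfies a Leibniz rule: the convolution of `x ∧ w` is the contraction of `w`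
by `ω x` plus `x` times the convolution of `w`. So if `w ≠ 0` has convolution zero and `x ∧ w = y ∧
w = 0`, then the contraction of `w` by `ω x` vanishes; contracting `y ∧ w = 0` by `ω x` leaves `ω x
y • w = 0`, hence `ω x y = 0` (`form_eq_zero_of_ι_mul_eq_zero`). Every vector of `H` thus yields an
isotropic subspace of `ω`.

The vectors `w_σ` have many annihilators. If positions `b < c` lie in one part, exchanging `b` and
`c` pairs the terms of `w_σ`, and `e_b ± e_c` kills `w_σ` as soon as the parity of the number of
elements of `I` between `b` and `c` is constant (`ι_mul_omitSum_eq_zero`). This applies to suitable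
`v_i = e_i + e_{i+2}` and `v_i - v_{i+2} = e_i - e_{i+4}`. Four kinds of `σ` suffice for `n ≥ 3`:
one block, all singletons, the complement of a point, and a pair of neighbours. They force `ω` to
vanish on nonadjacent basis vectors and its superdiagonal entries to be equal up to alternating
sign, so `ω = a • Λ`.

If `a = 0`, the kernel is all of `⋀^{n-1} V`. This is excluded by `tailFunctional`, a combination of
six coordinates that vanishes on every `w_σ` but equals `1` on a wedge of basis vectors of `V`. For
`n ≤ 2` the space of skew forms on `V` is at most one-dimensional. -/

noncomputable section

namespace Concordance

/-! ### Annihilators of kernel elements are isotropic -/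

section Isotropy

variable {W : Type*} [AddCommGroup W] [Module ℝ W]

/-- Moves computations to the full exterior algebra, where the recursion `convolutionAux_ι_mul` is
available. -/
theorem coe_convolution (ω : LinearMap.BilinForm ℝ W) (hω : IsSkewSymmetric ω) (k : ℕ)
    (w : ⋀[ℝ]^(k + 2) W) :
    (convolution ω hω (k + 2) w : ExteriorAlgebra ℝ W) = convolutionAux ω hω w := by
  have h : (Submodule.subtype _).comp (convolution ω hω (k + 2)) =
      (convolutionAux ω hω).comp (Submodule.subtype (⋀[ℝ]^(k + 2) W)) := by
    apply exteriorPower.linearMap_ext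
    ext x
    change (convolution ω hω (k + 2) (exteriorPower.ιMulti ℝ (k + 2) x) : ExteriorAlgebra ℝ W) =
      convolutionAux ω hω (ExteriorAlgebra.ιMulti ℝ (k + 2) x)
    rw [convolution_ιMulti, ← coe_convolutionFun]
    rfl
  exact LinearMap.congr_fun h w

/-- If `w ≠ 0` is killed by the convolution with `ω`, then the vectors that annihilate `w` under
left multiplication form an isotropic subspace. -/
theorem form_eq_zero_of_ι_mul_eq_zero (ω : LinearMap.BilinForm ℝ W) (hω : IsSkewSymmetric ω)
    {w : ExteriorAlgebra ℝ W} (hw : convolutionAux ω hω w = 0) (hw₀ : w ≠ 0) {x y : W}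
    (hx : ExteriorAlgebra.ι ℝ x * w = 0) (hy : ExteriorAlgebra.ι ℝ y * w = 0) : ω x y = 0 := by
  -- In the Leibniz rule for `x ∧ w`, every term but the contraction of `w` by `ω x` is zero.
  have h1 : (CliffordAlgebra.contractLeft (ω x) w : ExteriorAlgebra ℝ W) = 0 := by
    have := convolutionAux_ι_mul ω hω x w
    rw [hx, hw, map_zero, mul_zero, add_zero] at this
    exact this.symm
  have h2 := contractLeft_ι_mul_exterior (ω x) y w
  rw [hy, h1, mul_zero, sub_zero] at h2
  have h3 : ω x y • w = 0 := by
    rw [← h2]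
    exact map_zero (CliffordAlgebra.contractLeft (Q := (0 : QuadraticForm ℝ W)) (ω x))
  exact (smul_eq_zero.mp h3).resolve_right hw₀

end Isotropy

/-! ### Sets omitting one element of each class -/

section OmitsOne

variable {α : Type*}

/-- Each class of `π` has exactly one element outside `I`. -/
def OmitsOne (π : Setoid α) (I : Finset α) : Prop := ∀ p, ∃! q, π p q ∧ q ∉ I

theorem OmitsOne.mem {π : Setoid α} {I : Finset α} (h : OmitsOne π I) {b c : α} (hbc : π b c)
    (hne : b ≠ c) (hb : b ∉ I) : c ∈ I := by
  by_contra hc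
  exact hne ((h b).unique ⟨π.refl b, hb⟩ ⟨hbc, hc⟩)

theorem OmitsOne.notMem_of_forall_eq {π : Setoid α} {I : Finset α} (h : OmitsOne π I) {c : α}
    (hc : ∀ q, π c q → q = c) : c ∉ I := by
  obtain ⟨q, ⟨h1, h2⟩, -⟩ := h c
  rwa [hc q h1] at h2

theorem OmitsOne.mem_iff_of_forall_eq_or_eq {π : Setoid α} {I : Finset α} (h : OmitsOne π I)
    {c d : α} (hcd : π c d) (hne : c ≠ d) (hc : ∀ q, π c q → q = c ∨ q = d) :
    c ∈ I ↔ d ∉ I := by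
  constructor
  · intro hcI
    obtain ⟨q, ⟨h1, h2⟩, -⟩ := h c
    rcases hc q h1 with rfl | rfl
    · exact absurd hcI h2
    · exact h2
  · exact h.mem (π.symm hcd) hne.symm

variable [DecidableEq α]

/-- Only the class of `b` and `c` is affected: its omitted element changes from `b` to `c`. -/
theorem OmitsOne.swap {π : Setoid α} {I : Finset α} (h : OmitsOne π I) {b c : α} (hbc : π b c)
    (hne : b ≠ c) (hb : b ∉ I) : OmitsOne π (insert b (I.erase c)) := by
  intro p
  by_cases hp : π p b
  · refine ⟨c, ⟨π.trans hp hbc, by simp [hne.symm]⟩, ?_⟩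
    rintro q ⟨hq, hqI⟩
    simp only [Finset.mem_insert, Finset.mem_erase, not_or, not_and] at hqI
    by_contra hqc
    exact hqI.1 ((h p).unique ⟨hq, hqI.2 hqc⟩ ⟨hp, hb⟩)
  · obtain ⟨q, ⟨h1, h2⟩, h3⟩ := h p
    have hpc : ¬ π p c := fun hpc => hp (π.trans hpc (π.symm hbc))
    refine ⟨q, ⟨h1, ?_⟩, ?_⟩
    · simp only [Finset.mem_insert, Finset.mem_erase, not_or, not_and]
      exact ⟨fun e => hp (e ▸ h1), fun _ => h2⟩
    · rintro r ⟨hr, hrI⟩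
      simp only [Finset.mem_insert, Finset.mem_erase, not_or, not_and] at hrI
      exact h3 r ⟨hr, hrI.2 fun e => hpc (e ▸ hr)⟩

theorem OmitsOne.card_swap {I : Finset α} {b c : α} (hb : b ∉ I) (hc : c ∈ I) :
    (insert b (I.erase c)).card = I.card := by
  rw [Finset.card_insert_of_notMem (fun h => hb (Finset.mem_of_mem_erase h)),
    Finset.card_erase_add_one hc]

end OmitsOne

/-! ### Ordered wedges and linear annihilators of their sums -/

section Wedge

variable {M α : Type*} [AddCommGroup M] [Module ℝ M] [LinearOrder α]

/-- The product of the vectors `v i`, `i ∈ I`, in increasing order. -/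
def wedge (v : α → M) (I : Finset α) : ExteriorAlgebra ℝ M :=
  ((I.sort (· ≤ ·)).map fun i => ExteriorAlgebra.ι ℝ (v i)).prod

theorem wedge_insert_of_lt (v : α → M) {I : Finset α} {a : α} (h : ∀ b ∈ I, a < b) :
    wedge v (insert a I) = ExteriorAlgebra.ι ℝ (v a) * wedge v I := by
  rw [wedge, Finset.sort_insert (r := (· ≤ ·)) (fun b hb => (h b hb).le) fun ha => lt_irrefl _ (h a ha)]
  simp [wedge]

/-- The factor `v c` anticommutes past the factors with smaller index, one sign for each. -/
theorem ι_mul_wedge (v : α → M) {I : Finset α} {c : α} (hc : c ∉ I) :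
    ExteriorAlgebra.ι ℝ (v c) * wedge v I =
      (-1 : ℝ) ^ (I.filter (· < c)).card • wedge v (insert c I) := by
  induction I using Finset.induction_on_min with
  | empty => rw [wedge_insert_of_lt _ (by simp)]; simp
  | insert a I ha ih =>
    simp only [Finset.mem_insert, not_or] at hc
    rcases lt_or_gt_of_ne hc.1 with h | h
    · have hlt : ∀ b ∈ insert a I, c < b := by
        intro b hb
        rcases Finset.mem_insert.mp hb with rfl | hb
        · exact h
        · exact h.trans (ha b hb)
      rw [wedge_insert_of_lt _ hlt, Finset.filter_false_of_mem fun b hb => (hlt b hb).not_gt]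
      simp
    · have hna : a ∉ I.filter (· < c) := fun hm => lt_irrefl _ (ha a (Finset.mem_filter.mp hm).1)
      have hlt : ∀ b ∈ insert c I, a < b := by
        intro b hb
        rcases Finset.mem_insert.mp hb with rfl | hb
        · exact h
        · exact ha b hb
      rw [Finset.insert_comm, wedge_insert_of_lt _ hlt, wedge_insert_of_lt _ ha,
        Finset.filter_insert, if_pos h, Finset.card_insert_of_notMem hna, ← mul_assoc,
        eq_neg_of_add_eq_zero_left (ExteriorAlgebra.ι_add_mul_swap (v c) (v a)), neg_mul,
        mul_assoc, ih hc.2, mul_smul_comm, pow_succ]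
      simp

theorem ι_mul_wedge_of_mem (v : α → M) {I : Finset α} {c : α} (hc : c ∈ I) :
    ExteriorAlgebra.ι ℝ (v c) * wedge v I = 0 := by
  have h := ι_mul_wedge v (Finset.notMem_erase c I)
  rw [Finset.insert_erase hc] at h
  have h2 : wedge v I = (-1 : ℝ) ^ ((I.erase c).filter (· < c)).card •
      (ExteriorAlgebra.ι ℝ (v c) * wedge v (I.erase c)) := by
    rw [h, smul_smul, ← mul_pow]
    simp
  rw [h2, mul_smul_comm, ← mul_assoc, ExteriorAlgebra.ι_sq_zero, zero_mul, smul_zero]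

theorem coe_ιMulti_family_eq_wedge (v : α → M) {k : ℕ} (I : Set.powersetCard α k) :
    (exteriorPower.ιMulti_family ℝ k v I : ExteriorAlgebra ℝ M) = wedge v (I : Finset α) := by
  rw [exteriorPower.ιMulti_family_apply_coe, ExteriorAlgebra.ιMulti_family,
    ExteriorAlgebra.ιMulti_apply, wedge]
  congr 1
  apply List.ext_getElem
  · simp
  · intro i h₁ h₂
    simp only [List.getElem_ofFn, List.getElem_map, Set.powersetCard.ofFinEmbEquiv_symm_apply,
      Function.comp_apply]
    rfl

open Classical in
/-- The sum of the wedges over all `k`-element sets omitting one element of each class of `π`. -/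
def omitSum [Fintype α] (v : α → M) (π : Setoid α) (k : ℕ) : ExteriorAlgebra ℝ M :=
  ∑ I : Finset α with I.card = k ∧ OmitsOne π I, wedge v I

-- After multiplication by `v b` or `v c` only the sets missing that element survive. Sets missing
-- `b` and sets missing `c` correspond by the swap, which gives the same union; the signs of the two
-- wedges differ by the parity of the elements strictly between `b` and `c`, and by one more sign.
-- Hence `s` makes the terms cancel.
open Classical in
theorem ι_mul_omitSum_eq_zero [Fintype α] (v : α → M) (π : Setoid α) (k : ℕ) {b c : α}
    (hbc : π b c) (hlt : b < c) (s : ℝ)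
    (hs : ∀ I, OmitsOne π I → b ∉ I → (-1 : ℝ) ^ (I.filter fun i => b < i ∧ i < c).card = s) :
    ExteriorAlgebra.ι ℝ (v b + s • v c) * omitSum v π k = 0 := by
  have key : ∀ d : α, ExteriorAlgebra.ι ℝ (v d) * omitSum v π k =
      ∑ I : Finset α with (I.card = k ∧ OmitsOne π I) ∧ d ∉ I,
        (-1 : ℝ) ^ (I.filter (· < d)).card • wedge v (insert d I) := by
    intro d
    rw [omitSum, Finset.mul_sum,
      ← Finset.filter_filter (fun I : Finset α => I.card = k ∧ OmitsOne π I), Finset.sum_filter (fun I => d ∉ I)]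
    refine Finset.sum_congr rfl fun I _ => ?_
    split_ifs with h
    · exact ι_mul_wedge_of_mem v h
    · exact ι_mul_wedge v h
  rw [map_add, map_smul, add_mul, smul_mul_assoc, key, key, add_eq_zero_iff_eq_neg,
    ← neg_smul, Finset.smul_sum]
  refine Finset.sum_nbij' (fun I => insert b (I.erase c)) (fun I => insert c (I.erase b))
    ?_ ?_ ?_ ?_ ?_
  · intro I hI
    simp only [Finset.mem_filter, Finset.mem_univ, true_and] at hI ⊢
    obtain ⟨⟨h1, h2⟩, h3⟩ := hI
    have h4 := h2.mem hbc hlt.ne h3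
    exact ⟨⟨(OmitsOne.card_swap h3 h4).trans h1, h2.swap hbc hlt.ne h3⟩, by simp [hlt.ne']⟩
  · intro I hI
    simp only [Finset.mem_filter, Finset.mem_univ, true_and] at hI ⊢
    obtain ⟨⟨h1, h2⟩, h3⟩ := hI
    have h4 := h2.mem (π.symm hbc) hlt.ne' h3
    exact ⟨⟨(OmitsOne.card_swap h3 h4).trans h1, h2.swap (π.symm hbc) hlt.ne' h3⟩,
      by simp [hlt.ne]⟩
  · intro I hI
    simp only [Finset.mem_filter, Finset.mem_univ, true_and] at hI
    have h4 := hI.1.2.mem hbc hlt.ne hI.2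
    rw [Finset.erase_insert (fun h => hI.2 (Finset.mem_of_mem_erase h)), Finset.insert_erase h4]
  · intro I hI
    simp only [Finset.mem_filter, Finset.mem_univ, true_and] at hI
    have h4 := hI.1.2.mem (π.symm hbc) hlt.ne' hI.2
    rw [Finset.erase_insert (fun h => hI.2 (Finset.mem_of_mem_erase h)), Finset.insert_erase h4]
  · intro I hI
    simp only [Finset.mem_filter, Finset.mem_univ, true_and] at hI
    obtain ⟨⟨-, h2⟩, h3⟩ := hI
    have h4 := h2.mem hbc hlt.ne h3
    have e1 : insert c (insert b (I.erase c)) = insert b I := by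
      rw [Finset.insert_comm, Finset.insert_erase h4]
    -- The elements below `c` in the swapped set are those of `I` below `b`, those strictly between,
    -- and `b` itself; this last one produces the cancelling sign.
    have e2 : (insert b (I.erase c)).filter (· < c) =
        insert b (I.filter (· < b) ∪ I.filter fun i => b < i ∧ i < c) := by
      ext i
      simp only [Finset.mem_filter, Finset.mem_insert, Finset.mem_erase, Finset.mem_union]
      constructor
      · rintro ⟨rfl | ⟨-, h⟩, hic⟩
        · exact Or.inl rfl
        · rcases lt_trichotomy i b with hb | rfl | hb
          · exact Or.inr (Or.inl ⟨h, hb⟩)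
          · exact Or.inl rfl
          · exact Or.inr (Or.inr ⟨h, hb, hic⟩)
      · rintro (rfl | ⟨h, hb⟩ | ⟨h, -, hc⟩)
        · exact ⟨Or.inl rfl, hlt⟩
        · exact ⟨Or.inr ⟨(hb.trans hlt).ne, h⟩, hb.trans hlt⟩
        · exact ⟨Or.inr ⟨hc.ne, h⟩, hc⟩
    have e3 : ((insert b (I.erase c)).filter (· < c)).card =
        (I.filter (· < b)).card + (I.filter fun i => b < i ∧ i < c).card + 1 := by
      rw [e2, Finset.card_insert_of_notMem (by simp [h3]), Finset.card_union_of_disjoint]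
      rw [Finset.disjoint_filter]
      exact fun i _ hi hi' => hi.not_gt hi'.1
    have e4 : s * s = 1 := by rw [← hs I h2 h3, ← mul_pow]; simp
    rw [e1, e3, smul_smul, pow_succ, pow_add, hs I h2 h3]
    congr 1
    linear_combination (-(-1) ^ (I.filter (· < b)).card) * e4

end Wedge

/-! ### Passage to the ambient exterior algebra -/

section Isotropy

variable {W : Type*} [AddCommGroup W] [Module ℝ W]

theorem convolutionAux_eq_zero (ω : LinearMap.BilinForm ℝ W) (hω : IsSkewSymmetric ω) {k : ℕ}
    (hk : 2 ≤ k) {w : ⋀[ℝ]^k W} (hw : convolution ω hω k w = 0) :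
    convolutionAux ω hω w = 0 := by
  obtain ⟨k, rfl⟩ := Nat.exists_eq_add_of_le' hk
  rw [← coe_convolution, hw]
  rfl

theorem coe_exteriorPower_map {M N : Type*} [AddCommGroup M] [Module ℝ M] [AddCommGroup N]
    [Module ℝ N] (f : M →ₗ[ℝ] N) (k : ℕ) (w : ⋀[ℝ]^k M) :
    (exteriorPower.map k f w : ExteriorAlgebra ℝ N) = ExteriorAlgebra.map f w := by
  have h : (Submodule.subtype _).comp (exteriorPower.map k f) =
      (ExteriorAlgebra.map f).toLinearMap.comp (Submodule.subtype (⋀[ℝ]^k M)) := by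
    apply exteriorPower.linearMap_ext
    ext x
    change (exteriorPower.map k f (exteriorPower.ιMulti ℝ k x) : ExteriorAlgebra ℝ N) =
      ExteriorAlgebra.map f (ExteriorAlgebra.ιMulti ℝ k x)
    rw [exteriorPower.map_apply_ιMulti, ExteriorAlgebra.map_apply_ιMulti]
    rfl
  exact LinearMap.congr_fun h w

/-- Vectors of a subspace `U` that annihilate a nonzero image of an element of the kernel of the
convolution with a form on `U` are orthogonal for this form. -/
theorem form_eq_zero_of_mem_map_ker (U : Submodule ℝ W) (ω : LinearMap.BilinForm ℝ U)
    (hω : IsSkewSymmetric ω) {k : ℕ} (hk : 2 ≤ k) {w : ⋀[ℝ]^k W}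
    (hw : w ∈ (LinearMap.ker (convolution ω hω k)).map (exteriorPower.map k U.subtype))
    (hw₀ : w ≠ 0) {x y : U} (hx : ExteriorAlgebra.ι ℝ (x : W) * (w : ExteriorAlgebra ℝ W) = 0)
    (hy : ExteriorAlgebra.ι ℝ (y : W) * (w : ExteriorAlgebra ℝ W) = 0) : ω x y = 0 := by
  obtain ⟨u, hu, rfl⟩ := hw
  -- Injectivity of the map of exterior algebras pulls the relations `x ∧ w = 0` back from `W` to
  -- `U`, where the form lives.
  have hinj := ExteriorAlgebra.map_injective_field U.ker_subtype
  rw [coe_exteriorPower_map] at hx hy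
  have lift : ∀ z : U, ExteriorAlgebra.ι ℝ (z : W) * ExteriorAlgebra.map U.subtype u = 0 →
      ExteriorAlgebra.ι ℝ z * (u : ExteriorAlgebra ℝ U) = 0 := by
    intro z hz
    apply hinj
    rw [map_mul, ExteriorAlgebra.map_apply_ι, map_zero]
    exact hz
  refine form_eq_zero_of_ι_mul_eq_zero ω hω (convolutionAux_eq_zero ω hω hk hu) ?_
    (lift x hx) (lift y hy)
  intro h
  apply hw₀
  rw [show u = 0 from Subtype.ext h, map_zero]

end Isotropy

/-! ### Concordance on the circle of `2n` positions -/

section Positions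

variable {n : ℕ}

/-- The vertex `ī` or `ĩ` at position `p` has number `half p`. -/
def half (p : Fin (2 * n)) : Fin n := ⟨(p : ℕ) / 2, by omega⟩

theorem half_bar (i : Fin n) : half (bar i) = i := Fin.ext (by simp [half, bar_val])

theorem half_tilde (i : Fin n) : half (tilde i) = i := Fin.ext (by
  change (tilde i : ℕ) / 2 = i
  rw [tilde_val]; omega)

/-- The partition of all `2n` positions into the parts of `σ` and the parts of its dual. -/
def posSetoid (σ : Setoid (Fin n)) : Setoid (Fin (2 * n)) where
  r p q := (p : ℕ) % 2 = (q : ℕ) % 2 ∧ ((p : ℕ) % 2 = 0 → σ (half p) (half q)) ∧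
    ((p : ℕ) % 2 = 1 → dual σ (half p) (half q))
  iseqv :=
    { refl := fun _ => ⟨rfl, fun _ => σ.refl _, fun _ => (dual σ).refl _⟩
      symm := fun h => ⟨h.1.symm, fun h' => σ.symm (h.2.1 (h.1.trans h')),
        fun h' => (dual σ).symm (h.2.2 (h.1.trans h'))⟩
      trans := fun h₁ h₂ => ⟨h₁.1.trans h₂.1,
        fun h => σ.trans (h₁.2.1 h) (h₂.2.1 (h₁.1.symm.trans h)),
        fun h => (dual σ).trans (h₁.2.2 h) (h₂.2.2 (h₁.1.symm.trans h))⟩ }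

theorem posSetoid_iff (σ : Setoid (Fin n)) (p q : Fin (2 * n)) :
    posSetoid σ p q ↔ (p : ℕ) % 2 = (q : ℕ) % 2 ∧ ((p : ℕ) % 2 = 0 → σ (half p) (half q)) ∧
      ((p : ℕ) % 2 = 1 → dual σ (half p) (half q)) := Iff.rfl

theorem eq_bar_or_eq_tilde (p : Fin (2 * n)) :
    ((p : ℕ) % 2 = 0 ∧ p = bar (half p)) ∨ ((p : ℕ) % 2 = 1 ∧ p = tilde (half p)) := by
  rcases Nat.mod_two_eq_zero_or_one p with h | h
  · exact Or.inl ⟨h, Fin.ext (by rw [bar_val]; simp only [half]; omega)⟩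
  · exact Or.inr ⟨h, Fin.ext (by rw [tilde_val]; simp only [half]; omega)⟩

theorem posSetoid_bar (σ : Setoid (Fin n)) (i : Fin n) (q : Fin (2 * n)) :
    posSetoid σ (bar i) q ↔ ∃ j, q = bar j ∧ σ i j := by
  rw [posSetoid_iff, half_bar, bar_val]
  rcases eq_bar_or_eq_tilde q with ⟨h, hq⟩ | ⟨h, hq⟩
  · constructor
    · rintro ⟨-, h1, -⟩
      exact ⟨half q, hq, h1 (by omega)⟩
    · rintro ⟨j, rfl, hj⟩
      rw [half_bar]
      exact ⟨by omega, fun _ => hj, fun h => by omega⟩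
  · constructor
    · rintro ⟨h1, -⟩
      omega
    · rintro ⟨j, rfl, hj⟩
      rw [bar_val] at h
      omega

theorem posSetoid_tilde (σ : Setoid (Fin n)) (i : Fin n) (q : Fin (2 * n)) :
    posSetoid σ (tilde i) q ↔ ∃ j, q = tilde j ∧ dual σ i j := by
  rw [posSetoid_iff, half_tilde, tilde_val]
  rcases eq_bar_or_eq_tilde q with ⟨h, hq⟩ | ⟨h, hq⟩
  · constructor
    · rintro ⟨h1, -⟩
      omega
    · rintro ⟨j, rfl, hj⟩
      rw [tilde_val] at h
      omega
  · constructor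
    · rintro ⟨-, -, h1⟩
      exact ⟨half q, hq, h1 (by omega)⟩
    · rintro ⟨j, rfl, hj⟩
      rw [half_tilde]
      exact ⟨by omega, fun h => by omega, fun _ => hj⟩

theorem forall_classes_existsUnique_iff {α : Type*} (σ : Setoid α) (P : α → Prop) :
    (∀ B ∈ σ.classes, ∃! i, i ∈ B ∧ P i) ↔ ∀ i, ∃! j, σ i j ∧ P j := by
  have comm : ∀ i, (∃! j, j ∈ {x | σ x i} ∧ P j) ↔ ∃! j, σ i j ∧ P j := fun i =>
    existsUnique_congr fun j => and_congr_left fun _ => ⟨σ.symm, σ.symm⟩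
  constructor
  · exact fun h i => (comm i).mp (h _ (σ.mem_classes i))
  · rintro h B ⟨i, rfl⟩
    exact (comm i).mpr (h i)

theorem isConcordant_iff (σ : Setoid (Fin n)) (I : Finset (Fin (2 * n))) :
    IsConcordant σ I ↔ I.card = n - 1 ∧ (∀ i, ∃! j, σ i j ∧ bar j ∉ I) ∧
      ∀ i, ∃! j, dual σ i j ∧ tilde j ∉ I := by
  rw [IsConcordant, forall_classes_existsUnique_iff, forall_classes_existsUnique_iff]

theorem bar_injective : Function.Injective (bar : Fin n → Fin (2 * n)) :=
  Function.LeftInverse.injective half_bar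

theorem tilde_injective : Function.Injective (tilde : Fin n → Fin (2 * n)) :=
  Function.LeftInverse.injective half_tilde

theorem bar_ne_tilde (i j : Fin n) : bar i ≠ tilde j := by
  intro h
  have := congrArg Fin.val h
  rw [bar_val, tilde_val] at this
  omega

theorem isConcordant_iff_omitsOne (σ : Setoid (Fin n)) (I : Finset (Fin (2 * n))) :
    IsConcordant σ I ↔ I.card = n - 1 ∧ OmitsOne (posSetoid σ) I := by
  rw [isConcordant_iff]
  refine and_congr_right fun _ => ?_
  have hb : ∀ i, (∃! q, posSetoid σ (bar i) q ∧ q ∉ I) ↔ ∃! j, σ i j ∧ bar j ∉ I := by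
    intro i
    simp only [posSetoid_bar]
    constructor
    · rintro ⟨q, ⟨⟨j, rfl, hj⟩, hI⟩, hu⟩
      exact ⟨j, ⟨hj, hI⟩, fun l hl => bar_injective (hu _ ⟨⟨l, rfl, hl.1⟩, hl.2⟩)⟩
    · rintro ⟨j, ⟨hj, hI⟩, hu⟩
      refine ⟨bar j, ⟨⟨j, rfl, hj⟩, hI⟩, ?_⟩
      rintro q ⟨⟨l, rfl, hl⟩, hq⟩
      rw [hu l ⟨hl, hq⟩]
  have ht : ∀ i, (∃! q, posSetoid σ (tilde i) q ∧ q ∉ I) ↔ ∃! j, dual σ i j ∧ tilde j ∉ I := by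
    intro i
    simp only [posSetoid_tilde]
    constructor
    · rintro ⟨q, ⟨⟨j, rfl, hj⟩, hI⟩, hu⟩
      exact ⟨j, ⟨hj, hI⟩, fun l hl => tilde_injective (hu _ ⟨⟨l, rfl, hl.1⟩, hl.2⟩)⟩
    · rintro ⟨j, ⟨hj, hI⟩, hu⟩
      refine ⟨tilde j, ⟨⟨j, rfl, hj⟩, hI⟩, ?_⟩
      rintro q ⟨⟨l, rfl, hl⟩, hq⟩
      rw [hu l ⟨hl, hq⟩]
  constructor
  · rintro ⟨h1, h2⟩ p
    rcases eq_bar_or_eq_tilde p with ⟨-, hp⟩ | ⟨-, hp⟩ <;> rw [hp]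
    · exact (hb _).mpr (h1 _)
    · exact (ht _).mpr (h2 _)
  · exact fun h => ⟨fun i => (hb i).mp (h _), fun i => (ht i).mp (h _)⟩

theorem coe_concordanceVector (σ : Setoid (Fin n)) :
    (concordanceVector σ : ExteriorAlgebra ℝ (Fin (2 * n) → ℝ)) =
      omitSum (Pi.basisFun ℝ (Fin (2 * n))) (posSetoid σ) (n - 1) := by
  classical
  have h : (concordanceVector σ : ExteriorAlgebra ℝ (Fin (2 * n) → ℝ)) =
      ∑ I : Set.powersetCard (Fin (2 * n)) (n - 1),
        if IsConcordant σ (I : Finset (Fin (2 * n))) then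
          wedge (Pi.basisFun ℝ (Fin (2 * n))) (I : Finset (Fin (2 * n))) else 0 := by
    rw [concordanceVector, Submodule.coe_sum]
    refine Finset.sum_congr rfl fun I _ => ?_
    split_ifs
    · rw [one_smul, eWedge, coe_ιMulti_family_eq_wedge]
    · rw [zero_smul]; rfl
  rw [h, ← Finset.sum_filter, omitSum]
  refine Finset.sum_bij (fun I _ => (I : Finset (Fin (2 * n)))) ?_ ?_ ?_ ?_
  · intro I hI
    simpa [isConcordant_iff_omitsOne] using hI
  · exact fun I _ J _ h => Subtype.ext h
  · intro I hI
    simp only [Finset.mem_filter, Finset.mem_univ, true_and] at hI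
    exact ⟨⟨I, hI.1⟩, by simpa [isConcordant_iff_omitsOne] using hI.2, rfl⟩
  · exact fun _ _ => rfl

/-- The `e_I` form a basis, so a coordinate of `w_σ` just tests concordance. This serves both to see
that `w_σ ≠ 0` and to evaluate `tailFunctional`. -/
theorem ιMultiDual_concordanceVector (σ : Setoid (Fin n))
    (I : Set.powersetCard (Fin (2 * n)) (n - 1)) [Decidable (IsConcordant σ I.1)] :
    exteriorPower.ιMultiDual ℝ (n - 1) (Pi.basisFun ℝ (Fin (2 * n))) I (concordanceVector σ) =
      if IsConcordant σ I.1 then 1 else 0 := by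
  rw [concordanceVector, map_sum, Finset.sum_eq_single I]
  · rw [map_smul, eWedge, exteriorPower.ιMultiDual_apply_diag]
    split_ifs <;> simp
  · intro J _ hJ
    rw [map_smul, eWedge, exteriorPower.ιMultiDual_apply_nondiag _ _ _ _ _ hJ.symm, smul_zero]
  · simp

theorem concordanceVector_ne_zero {σ : Setoid (Fin n)} {I : Finset (Fin (2 * n))}
    (hI : IsConcordant σ I) : concordanceVector σ ≠ 0 := by
  classical
  intro h
  have := ιMultiDual_concordanceVector σ ⟨I, hI.1⟩
  rw [h, map_zero, if_pos hI] at this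
  exact zero_ne_one this

/-- The only position between `i` and `i + 2` is a singleton part, hence never in `I`: the number of
elements between is `0` and the sign is `+1`. -/
theorem ι_vVec_mul_concordanceVector (σ : Setoid (Fin n)) (i : Fin (2 * n - 2))
    (h₁ : posSetoid σ ⟨i, by omega⟩ ⟨i + 2, by omega⟩)
    (h₂ : ∀ q, posSetoid σ ⟨i + 1, by omega⟩ q → q = ⟨i + 1, by omega⟩) :
    ExteriorAlgebra.ι ℝ (vVec n i) *
      (concordanceVector σ : ExteriorAlgebra ℝ (Fin (2 * n) → ℝ)) = 0 := by
  have hv : vVec n i = Pi.basisFun ℝ (Fin (2 * n)) ⟨i, by omega⟩ +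
      (1 : ℝ) • Pi.basisFun ℝ (Fin (2 * n)) ⟨i + 2, by omega⟩ := by
    ext k
    simp only [vVec, Pi.add_apply, Pi.basisFun_apply, Pi.single_apply, Fin.ext_iff, one_smul]
    split_ifs <;> first | omega | simp
  rw [hv, coe_concordanceVector]
  refine ι_mul_omitSum_eq_zero _ _ _ h₁ (by simp [Fin.lt_def]) _ fun I hI _ => ?_
  rw [Finset.card_eq_zero.mpr, pow_zero]
  rw [Finset.filter_eq_empty_iff]
  rintro q hq ⟨hq₁, hq₂⟩
  rw [Fin.lt_def] at hq₁ hq₂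
  have : q = ⟨i + 1, by omega⟩ := Fin.ext (by simp only at hq₁ hq₂ ⊢; omega)
  exact hI.notMem_of_forall_eq h₂ (this ▸ hq)

/-- The difference is `e_i - e_{i+4}`. Of the three positions between, the middle one is a singleton
part and never in `I`, and the outer two form a part, so exactly one of them is in `I`: the sign is
`-1`. -/
theorem ι_vVec_sub_vVec_mul_concordanceVector (σ : Setoid (Fin n)) (i j : Fin (2 * n - 2))
    (hij : (j : ℕ) = i + 2)
    (h₁ : posSetoid σ ⟨i, by omega⟩ ⟨i + 4, by omega⟩)
    (h₂ : ∀ q, posSetoid σ ⟨i + 2, by omega⟩ q → q = ⟨i + 2, by omega⟩)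
    (h₃ : posSetoid σ ⟨i + 1, by omega⟩ ⟨i + 3, by omega⟩)
    (h₄ : ∀ q, posSetoid σ ⟨i + 1, by omega⟩ q → q = ⟨i + 1, by omega⟩ ∨ q = ⟨i + 3, by omega⟩) :
    ExteriorAlgebra.ι ℝ (vVec n i - vVec n j) *
      (concordanceVector σ : ExteriorAlgebra ℝ (Fin (2 * n) → ℝ)) = 0 := by
  have hv : vVec n i - vVec n j = Pi.basisFun ℝ (Fin (2 * n)) ⟨i, by omega⟩ +
      (-1 : ℝ) • Pi.basisFun ℝ (Fin (2 * n)) ⟨i + 4, by omega⟩ := by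
    ext k
    simp only [vVec, Pi.add_apply, Pi.sub_apply, Pi.smul_apply, Pi.basisFun_apply,
      Pi.single_apply, Fin.ext_iff, smul_eq_mul]
    split_ifs <;> first | omega | simp
  rw [hv, coe_concordanceVector]
  refine ι_mul_omitSum_eq_zero _ _ _ h₁ (by simp [Fin.lt_def]) _ fun I hI _ => ?_
  have hm := hI.notMem_of_forall_eq h₂
  have hiff := hI.mem_iff_of_forall_eq_or_eq h₃ (by simp [Fin.ext_iff]) h₄
  have hmid : ∀ q : Fin (2 * n), q ∈ I → (i : ℕ) < q → (q : ℕ) < i + 4 →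
      q = ⟨i + 1, by omega⟩ ∨ q = ⟨i + 3, by omega⟩ := by
    intro q hq hq₁ hq₂
    have : (q : ℕ) ≠ i + 2 := fun e => hm ((Fin.ext e : q = ⟨i + 2, by omega⟩) ▸ hq)
    simp only [Fin.ext_iff]
    omega
  have hcard : (I.filter fun q => (⟨i, by omega⟩ : Fin (2 * n)) < q ∧ q < ⟨i + 4, by omega⟩).card
      = 1 := by
    rw [Finset.card_eq_one]
    by_cases h : (⟨i + 1, by omega⟩ : Fin (2 * n)) ∈ I
    · refine ⟨⟨i + 1, by omega⟩, ?_⟩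
      ext q
      simp only [Finset.mem_filter, Finset.mem_singleton, Fin.lt_def]
      constructor
      · rintro ⟨hq, hq₁, hq₂⟩
        rcases hmid q hq hq₁ hq₂ with e | e
        · exact e
        · exact absurd (e ▸ hq) (hiff.mp h)
      · rintro rfl
        exact ⟨h, by simp, by simp⟩
    · refine ⟨⟨i + 3, by omega⟩, ?_⟩
      ext q
      simp only [Finset.mem_filter, Finset.mem_singleton, Fin.lt_def]
      constructor
      · rintro ⟨hq, hq₁, hq₂⟩
        rcases hmid q hq hq₁ hq₂ with e | e
        · exact absurd (e ▸ hq) h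
        · exact e
      · rintro rfl
        exact ⟨by_contra fun h' => h (hiff.mpr h'), by simp, by simp⟩
  rw [hcard, pow_one]

end Positions

/-! ### Partitions with a single nontrivial block, and their duals -/

section Blocks

variable {n : ℕ}

/-- The partition whose parts are `S` and the singletons of elements outside `S`. -/
def block (S : Finset (Fin n)) : Setoid (Fin n) where
  r i j := i = j ∨ i ∈ S ∧ j ∈ S
  iseqv :=
    { refl := fun _ => Or.inl rfl
      symm := by
        rintro i j (rfl | ⟨h₁, h₂⟩)
        · exact Or.inl rfl
        · exact Or.inr ⟨h₂, h₁⟩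
      trans := by
        rintro i j k (rfl | ⟨h₁, h₂⟩) (rfl | ⟨h₃, h₄⟩)
        · exact Or.inl rfl
        · exact Or.inr ⟨h₃, h₄⟩
        · exact Or.inr ⟨h₁, h₂⟩
        · exact Or.inr ⟨h₁, h₄⟩ }

theorem block_iff (S : Finset (Fin n)) (i j : Fin n) : block S i j ↔ i = j ∨ i ∈ S ∧ j ∈ S :=
  Iff.rfl

theorem isNonCrossing_block (S : Finset (Fin n)) : IsNonCrossing (block S) := by
  intro i j k l hij hjk hkl hik hjl
  rw [block_iff] at *
  rcases hik with rfl | hik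
  · exact absurd (hij.trans hjk) (lt_irrefl _)
  rcases hjl with rfl | hjl
  · exact absurd (hjk.trans hkl) (lt_irrefl _)
  exact Or.inr ⟨hik.1, hjl.1⟩

theorem dual_iff (σ : Setoid (Fin n)) (i j : Fin n) :
    dual σ i j ↔ ∀ a b : Fin n, σ a b → ((a ≤ i ↔ a ≤ j) ↔ (b ≤ i ↔ b ≤ j)) := Iff.rfl

theorem dual_block_iff (S : Finset (Fin n)) (i j : Fin n) :
    dual (block S) i j ↔
      ∀ a ∈ S, ∀ b ∈ S, ((a ≤ i ↔ a ≤ j) ↔ (b ≤ i ↔ b ≤ j)) := by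
  rw [dual_iff]
  constructor
  · exact fun h a ha b hb => h a b (Or.inr ⟨ha, hb⟩)
  · rintro h a b (rfl | ⟨ha, hb⟩)
    · rfl
    · exact h a ha b hb

theorem dual_block_eq_of_lt {S T : Finset (Fin n)}
    (h₁ : ∀ i j, i < j → dual (block S) i j → i ∈ T ∧ j ∈ T)
    (h₂ : ∀ i j, i < j → i ∈ T → j ∈ T → dual (block S) i j) : dual (block S) = block T := by
  ext i j
  rw [block_iff]
  rcases lt_trichotomy i j with h | rfl | h
  · exact ⟨fun hd => Or.inr (h₁ i j h hd), fun ht => h₂ i j h (ht.resolve_left h.ne).1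
      (ht.resolve_left h.ne).2⟩
  · exact ⟨fun _ => Or.inl rfl, fun _ => (dual (block S)).refl _⟩
  · refine ⟨fun hd => Or.inr (h₁ j i h ((dual (block S)).symm hd)).symm, fun ht => ?_⟩
    have := ht.resolve_left h.ne'
    exact (dual (block S)).symm (h₂ j i h this.2 this.1)

theorem dual_block_univ : dual (block (Finset.univ : Finset (Fin n))) = block ∅ := by
  refine dual_block_eq_of_lt (fun i j hij hd => ?_) (by simp)
  rw [dual_block_iff] at hd
  have := hd i (Finset.mem_univ _) j (Finset.mem_univ _)
  simp only [Fin.le_def, Fin.lt_def] at *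
  omega

theorem dual_block_empty : dual (block (∅ : Finset (Fin n))) = block Finset.univ :=
  dual_block_eq_of_lt (by simp) fun i j _ _ _ => by simp [dual_block_iff]

/-- For `i < j` the chord cuts off the points `a` with `i < a ≤ j`. It respects the block only if
this set is `{k}` or contains all other points; the latter would force `i = k` to be the first
point, which `k = l + 1` rules out. -/
theorem dual_block_compl {k l : Fin n} (hkl : (k : ℕ) = l + 1) :
    dual (block {k}ᶜ) = block {l, k} := by
  refine dual_block_eq_of_lt (fun i j hij hd => ?_) fun i j hij hi hj => ?_
  · rw [dual_block_iff] at hd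
    have h₁ := hd l (by simp [Fin.ext_iff]; omega)
    simp only [Finset.mem_compl, Finset.mem_singleton, Finset.mem_insert, Fin.ext_iff, Fin.le_def,
      Fin.lt_def] at *
    have h₂ := h₁ i
    have h₃ := h₁ j
    have h₄ := hd i
    have h₅ := fun h => h₄ h j
    omega
  · rw [dual_block_iff]
    intro a ha b hb
    simp only [Finset.mem_compl, Finset.mem_singleton, Finset.mem_insert, Fin.ext_iff, Fin.le_def,
      Fin.lt_def] at *
    omega

/-- A chord separates the neighbours `m` and `m + 1` exactly when one of its ends is `m̃`, the
vertex between them. -/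
theorem dual_block_pair {m k : Fin n} (hmk : (k : ℕ) = m + 1) :
    dual (block {m, k}) = block {m}ᶜ := by
  refine dual_block_eq_of_lt (fun i j hij hd => ?_) fun i j hij hi hj => ?_
  · rw [dual_block_iff] at hd
    have := hd m (by simp) k (by simp)
    simp only [Finset.mem_compl, Finset.mem_singleton, Fin.ext_iff, Fin.le_def, Fin.lt_def] at *
    omega
  · rw [dual_block_iff]
    intro a ha b hb
    simp only [Finset.mem_compl, Finset.mem_singleton, Finset.mem_insert, Fin.ext_iff, Fin.le_def,
      Fin.lt_def] at *
    omega

/-- The set of positions `ā`, `a ∈ A`, and `b̃`, `b ∈ B`. -/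
def positions (A B : Finset (Fin n)) : Finset (Fin (2 * n)) :=
  A.map ⟨bar, bar_injective⟩ ∪ B.map ⟨tilde, tilde_injective⟩

theorem card_positions (A B : Finset (Fin n)) : (positions A B).card = A.card + B.card := by
  rw [positions, Finset.card_union_of_disjoint, Finset.card_map, Finset.card_map]
  rw [Finset.disjoint_left]
  intro p hA hB
  obtain ⟨i, -, rfl⟩ := Finset.mem_map.mp hA
  obtain ⟨j, -, h⟩ := Finset.mem_map.mp hB
  exact bar_ne_tilde i j h.symm

theorem bar_mem_positions (A B : Finset (Fin n)) (i : Fin n) : bar i ∈ positions A B ↔ i ∈ A := by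
  simp [positions, (bar_ne_tilde _ _).symm]

theorem tilde_mem_positions (A B : Finset (Fin n)) (i : Fin n) :
    tilde i ∈ positions A B ↔ i ∈ B := by
  simp [positions, bar_ne_tilde]

theorem isConcordant_positions_iff (σ : Setoid (Fin n)) (A B : Finset (Fin n)) :
    IsConcordant σ (positions A B) ↔ A.card + B.card = n - 1 ∧ (∀ i, ∃! j, σ i j ∧ j ∉ A) ∧
      ∀ i, ∃! j, dual σ i j ∧ j ∉ B := by
  simp only [isConcordant_iff, card_positions, bar_mem_positions, tilde_mem_positions]

theorem exists_omitting_block (S : Finset (Fin n)) :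
    ∃ A : Finset (Fin n), A.card = S.card - 1 ∧ ∀ i, ∃! j, block S i j ∧ j ∉ A := by
  rcases S.eq_empty_or_nonempty with rfl | ⟨m, hm⟩
  · refine ⟨∅, rfl, fun i => ⟨i, by simp, ?_⟩⟩
    rintro j ⟨hj | hj, -⟩
    · exact hj.symm
    · simp at hj
  · refine ⟨S.erase m, Finset.card_erase_of_mem hm, fun i => ?_⟩
    by_cases hi : i ∈ S
    · refine ⟨m, ⟨Or.inr ⟨hi, hm⟩, by simp⟩, ?_⟩
      rintro j ⟨hj | hj, hjA⟩
      · subst hj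
        by_contra h
        exact hjA (Finset.mem_erase.mpr ⟨h, hi⟩)
      · by_contra h
        exact hjA (Finset.mem_erase.mpr ⟨h, hj.2⟩)
    · refine ⟨i, ⟨Or.inl rfl, fun h => hi (Finset.mem_of_mem_erase h)⟩, ?_⟩
      rintro j ⟨hj | hj, -⟩
      · exact hj.symm
      · exact absurd hj.1 hi

/-- Dropping one element from each of `S` and `T` gives a concordant set; `hc` says that it has the
right size. -/
theorem concordanceVector_block_ne_zero {S T : Finset (Fin n)} (hd : dual (block S) = block T)
    (hc : (S.card - 1) + (T.card - 1) = n - 1) : concordanceVector (block S) ≠ 0 := by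
  obtain ⟨A, hA, hA'⟩ := exists_omitting_block S
  obtain ⟨B, hB, hB'⟩ := exists_omitting_block T
  exact concordanceVector_ne_zero
    ((isConcordant_positions_iff _ A B).mpr ⟨by rw [hA, hB, hc], hA', hd ▸ hB'⟩)

theorem posSetoid_block_iff {S T : Finset (Fin n)} (hd : dual (block S) = block T)
    (p q : Fin (2 * n)) :
    posSetoid (block S) p q ↔ p = q ∨ (p : ℕ) % 2 = (q : ℕ) % 2 ∧
      ((p : ℕ) % 2 = 0 → half p ∈ S ∧ half q ∈ S) ∧
      ((p : ℕ) % 2 = 1 → half p ∈ T ∧ half q ∈ T) := by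
  rw [posSetoid_iff, hd, block_iff, block_iff]
  have : (p : ℕ) % 2 = (q : ℕ) % 2 → (half p = half q ↔ p = q) := by
    intro h
    simp only [half, Fin.ext_iff]
    omega
  constructor
  · rintro ⟨h, h₁, h₂⟩
    rw [this h] at h₁ h₂
    by_cases hpq : p = q
    · exact Or.inl hpq
    · exact Or.inr ⟨h, fun h' => (h₁ h').resolve_left hpq, fun h' => (h₂ h').resolve_left hpq⟩
  · rintro (rfl | ⟨h, h₁, h₂⟩)
    · exact ⟨rfl, fun _ => Or.inl rfl, fun _ => Or.inl rfl⟩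
    · exact ⟨h, fun h' => Or.inr (h₁ h'), fun h' => Or.inr (h₂ h')⟩

end Blocks

/-! ### Relations between the values of `ω` on the basis -/

section Relations

variable {n : ℕ} {ω : LinearMap.BilinForm ℝ (V n)} {hω : IsSkewSymmetric ω}

theorem form_eq_zero_of_concordanceSpace_le (hn : 3 ≤ n)
    (hker : concordanceSpace n ≤ (LinearMap.ker (convolution ω hω (n - 1))).map
      (exteriorPower.map (n - 1) (V n).subtype))
    {σ : Setoid (Fin n)} (hσ : IsNonCrossing σ) (hσ₀ : concordanceVector σ ≠ 0) {x y : V n}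
    (hx : ExteriorAlgebra.ι ℝ (x : Fin (2 * n) → ℝ) *
      (concordanceVector σ : ExteriorAlgebra ℝ (Fin (2 * n) → ℝ)) = 0)
    (hy : ExteriorAlgebra.ι ℝ (y : Fin (2 * n) → ℝ) *
      (concordanceVector σ : ExteriorAlgebra ℝ (Fin (2 * n) → ℝ)) = 0) : ω x y = 0 :=
  form_eq_zero_of_mem_map_ker (V n) ω hω (by omega)
    (hker (Submodule.subset_span ⟨σ, hσ, rfl⟩)) hσ₀ hx hy

variable (hn : 3 ≤ n)
    (hker : concordanceSpace n ≤ (LinearMap.ker (convolution ω hω (n - 1))).map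
      (exteriorPower.map (n - 1) (V n).subtype))

include hn hker

/-- From the one-block partition: the even positions form one part and the odd ones are singletons,
so every `v_i` with `i` even annihilates `w_σ`. -/
theorem form_vBasis_eq_zero_of_even {i j : Fin (2 * n - 2)} (hi : (i : ℕ) % 2 = 0)
    (hj : (j : ℕ) % 2 = 0) : ω (vBasis n i) (vBasis n j) = 0 := by
  have key : ∀ i : Fin (2 * n - 2), (i : ℕ) % 2 = 0 →
      ExteriorAlgebra.ι ℝ (vBasis n i : Fin (2 * n) → ℝ) *
        (concordanceVector (block (Finset.univ : Finset (Fin n))) : ExteriorAlgebra ℝ (Fin (2 * n) → ℝ)) = 0 := by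
    intro i hi
    rw [coe_vBasis]
    refine ι_vVec_mul_concordanceVector _ _ ?_ fun q => ?_
    · simp [posSetoid_block_iff dual_block_univ, hi]
    · simp only [posSetoid_block_iff dual_block_univ, Finset.notMem_empty, Finset.mem_univ, Fin.ext_iff,
        and_self, implies_true, imp_false, true_and]
      omega
  exact form_eq_zero_of_concordanceSpace_le hn hker (isNonCrossing_block _)
    (concordanceVector_block_ne_zero dual_block_univ (by simp)) (key i hi) (key j hj)

theorem form_vBasis_eq_zero_of_odd {i j : Fin (2 * n - 2)} (hi : (i : ℕ) % 2 = 1)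
    (hj : (j : ℕ) % 2 = 1) : ω (vBasis n i) (vBasis n j) = 0 := by
  have key : ∀ i : Fin (2 * n - 2), (i : ℕ) % 2 = 1 →
      ExteriorAlgebra.ι ℝ (vBasis n i : Fin (2 * n) → ℝ) *
        (concordanceVector (block (∅ : Finset (Fin n))) : ExteriorAlgebra ℝ (Fin (2 * n) → ℝ)) = 0 := by
    intro i hi
    rw [coe_vBasis]
    refine ι_vVec_mul_concordanceVector _ _ ?_ fun q => ?_
    · simp [posSetoid_block_iff dual_block_empty, hi]
    · simp only [posSetoid_block_iff dual_block_empty, Finset.notMem_empty, Finset.mem_univ, Fin.ext_iff,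
        and_self, implies_true, imp_false, and_true]
      omega
  exact form_eq_zero_of_concordanceSpace_le hn hker (isNonCrossing_block _)
    (concordanceVector_block_ne_zero dual_block_empty (by simp)) (key i hi) (key j hj)

/-- Take `σ` with the singleton `{k}`, where `k̄` is position `j + 1`, and one block of all other
points. Its dual joins only positions `j` and `j + 2`, so `v_j` annihilates `w_σ`, as do the even
`v_i` away from `j` and the difference of the two neighbours of `v_j`. -/
theorem form_vBasis_odd {j : Fin (2 * n - 2)} (hj : (j : ℕ) % 2 = 1) :
    (∀ i : Fin (2 * n - 2), (i : ℕ) % 2 = 0 → (i : ℕ) + 1 ≠ j → (i : ℕ) ≠ j + 1 →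
      ω (vBasis n j) (vBasis n i) = 0) ∧
    ∀ i k : Fin (2 * n - 2), (j : ℕ) = i + 1 → (k : ℕ) = j + 1 →
      ω (vBasis n j) (vBasis n i) = ω (vBasis n j) (vBasis n k) := by
  have hj2 := j.2
  have hl : (j : ℕ) / 2 < n := by omega
  have hk : (j : ℕ) / 2 + 1 < n := by omega
  have hd := dual_block_compl (k := ⟨_, hk⟩) (l := ⟨_, hl⟩) rfl
  have hw := concordanceVector_block_ne_zero hd (by
    rw [Finset.card_compl, Finset.card_pair (by simp [Fin.ext_iff])]
    simp only [Fintype.card_fin, Finset.card_singleton]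
    omega)
  have hjw : ExteriorAlgebra.ι ℝ (vBasis n j : Fin (2 * n) → ℝ) *
      (concordanceVector (block {⟨_, hk⟩}ᶜ) : ExteriorAlgebra ℝ (Fin (2 * n) → ℝ)) = 0 := by
    rw [coe_vBasis]
    refine ι_vVec_mul_concordanceVector _ _ ?_ fun q => ?_ <;>
    · simp only [posSetoid_block_iff hd, Finset.mem_compl, Finset.mem_singleton,
        Finset.mem_insert, Fin.ext_iff, half, true_or, true_and]
      omega
  constructor
  · intro i hi h₁ h₂
    refine form_eq_zero_of_concordanceSpace_le hn hker (isNonCrossing_block _) hw hjw ?_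
    rw [coe_vBasis]
    refine ι_vVec_mul_concordanceVector _ _ ?_ fun q => ?_ <;>
    · simp only [posSetoid_block_iff hd, Finset.mem_compl, Finset.mem_singleton,
        Finset.mem_insert, Fin.ext_iff, half]
      omega
  · intro i k hi hk'
    rw [← sub_eq_zero, ← map_sub]
    refine form_eq_zero_of_concordanceSpace_le hn hker (isNonCrossing_block _) hw hjw ?_
    rw [Submodule.coe_sub, coe_vBasis, coe_vBasis]
    have hk2 := k.2
    refine ι_vVec_sub_vVec_mul_concordanceVector _ _ _ (by omega) ?_ (fun q => ?_) ?_ fun q => ?_ <;>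
    · simp only [posSetoid_block_iff hd, Finset.mem_compl, Finset.mem_singleton,
        Finset.mem_insert, Fin.ext_iff, half]
      omega

/-- Bars and tildes exchange roles: here `σ` joins only positions `j` and `j + 2`, and its dual
joins all odd positions except `j + 1`. -/
theorem form_vBasis_even {i j k : Fin (2 * n - 2)} (hj : (j : ℕ) % 2 = 0) (hi : (j : ℕ) = i + 1)
    (hk : (k : ℕ) = j + 1) : ω (vBasis n j) (vBasis n i) = ω (vBasis n j) (vBasis n k) := by
  have hk2 := k.2
  have hm : (j : ℕ) / 2 < n := by omega
  have hm' : (j : ℕ) / 2 + 1 < n := by omega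
  have hd := dual_block_pair (k := ⟨_, hm'⟩) (m := ⟨_, hm⟩) rfl
  have hw := concordanceVector_block_ne_zero hd (by
    rw [Finset.card_compl, Finset.card_pair (by simp [Fin.ext_iff])]
    simp only [Fintype.card_fin, Finset.card_singleton]
    omega)
  rw [← sub_eq_zero, ← map_sub]
  refine form_eq_zero_of_concordanceSpace_le hn hker (isNonCrossing_block _) hw ?_ ?_
  · rw [coe_vBasis]
    refine ι_vVec_mul_concordanceVector _ _ ?_ fun q => ?_ <;>
    · simp only [posSetoid_block_iff hd, Finset.mem_compl, Finset.mem_singleton,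
        Finset.mem_insert, Fin.ext_iff, half, true_or, true_and, not_true_eq_false, false_and,
        imp_false]
      omega
  · rw [Submodule.coe_sub, coe_vBasis, coe_vBasis]
    refine ι_vVec_sub_vVec_mul_concordanceVector _ _ _ (by omega) ?_ (fun q => ?_) ?_ fun q => ?_ <;>
    · simp only [posSetoid_block_iff hd, Finset.mem_compl, Finset.mem_singleton,
        Finset.mem_insert, Fin.ext_iff, half]
      omega

end Relations

/-! ### A functional separating the concordance space from `⋀^{n-1} V` -/

section Nonvanishing

variable {n : ℕ}

/-- All but the last three elements, together with `p`. -/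
def headInsert (p : Fin n) : Finset (Fin n) := 
  insert p (Finset.univ.filter fun i => (i : ℕ) < n - 3)

theorem mem_headInsert (p i : Fin n) : i ∈ headInsert p ↔ i = p ∨ (i : ℕ) < n - 3 := by
  simp [headInsert]

theorem card_headInsert (hn : 3 ≤ n) {p : Fin n} (hp : n - 3 ≤ p) :
    (headInsert p).card = n - 2 := by
  rw [headInsert, Finset.card_insert_of_notMem (by simpa using hp), Fin.card_filter_val_lt]
  omega

theorem headInsert_swap {p r : Fin n} (hp : n - 3 ≤ p) :
    insert r ((headInsert p).erase p) = headInsert r := by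
  ext i
  simp only [Finset.mem_insert, Finset.mem_erase, mem_headInsert, Fin.ext_iff] at *
  omega

/-- The omitted element `r` of the class of `p` is one of the last three, and it can be swapped with
`p`. Hence the indices `p` for which `headInsert p` omits one element per class never occur alone.
-/
theorem OmitsOne.exists_ne_of_headInsert {σ : Setoid (Fin n)} {p : Fin n} (hp : n - 3 ≤ p)
    (h : OmitsOne σ (headInsert p)) :
    ∃ r : Fin n, n - 3 ≤ r ∧ r ≠ p ∧ σ p r ∧ OmitsOne σ (headInsert r) := by
  obtain ⟨r, ⟨h₁, h₂⟩, -⟩ := h p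
  rw [mem_headInsert, not_or, not_lt] at h₂
  refine ⟨r, h₂.2, h₂.1, h₁, ?_⟩
  rw [← headInsert_swap hp]
  exact h.swap (σ.symm h₁) h₂.1 (by rw [mem_headInsert, not_or, not_lt]; exact h₂)

theorem OmitsOne.rel_of_headInsert {σ : Setoid (Fin n)} {p r : Fin n} (hp : n - 3 ≤ p)
    (hpr : p ≠ r) (h : OmitsOne σ (headInsert p))
    (h' : OmitsOne σ (headInsert r)) : σ p r := by
  obtain ⟨s, hs, hsp, hps, -⟩ := h.exists_ne_of_headInsert hp
  by_cases hsr : s = r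
  · exact hsr ▸ hps
  · have := h'.mem hps hsp.symm (by rw [mem_headInsert, not_or, not_lt]; exact ⟨hpr, hp⟩)
    rw [mem_headInsert] at this
    rcases this with e | e
    · exact absurd e hsr
    · omega

theorem OmitsOne.not_rel_of_headInsert {σ : Setoid (Fin n)} {p r s : Fin n} (hr : n - 3 ≤ r)
    (hs : n - 3 ≤ s) (hpr : r ≠ p) (hps : s ≠ p) (hrs : r ≠ s) (h : OmitsOne σ (headInsert p)) :
    ¬ σ r s := by
  intro hσ
  have := h.mem hσ hrs (by rw [mem_headInsert, not_or, not_lt]; exact ⟨hpr, hr⟩)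
  rw [mem_headInsert] at this
  rcases this with e | e
  · exact hps e
  · omega

theorem OmitsOne.exists_ne_of_singleton {α : Type*} [DecidableEq α] {τ : Setoid α} {q : α}
    (h : OmitsOne τ {q}) : ∃ r, r ≠ q ∧ τ q r ∧ OmitsOne τ {r} := by
  obtain ⟨r, ⟨h₁, h₂⟩, -⟩ := h q
  rw [Finset.mem_singleton] at h₂
  refine ⟨r, h₂, h₁, ?_⟩
  have := h.swap (τ.symm h₁) h₂ (by simpa using h₂)
  simpa using this

/-- The chord from `p̄` to its neighbour isolates `p̃`, making it a singleton of the dual, whose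
only element cannot lie in the set. -/
theorem not_omitsOne_dual_of_rel_succ {σ : Setoid (Fin n)} {p r : Fin n} (hpr : (r : ℕ) = p + 1)
    (h : σ p r) : ¬ OmitsOne (dual σ) {p} := by
  intro hT
  obtain ⟨q, hq, hd, -⟩ := hT.exists_ne_of_singleton
  have := hd p r h
  simp only [Fin.le_def, Fin.ext_iff, ne_eq] at *
  omega

/-- The chord from `p̄` to `r̄` leaves `p̃` and `q̃` no possible partners but each other, and
swapping them exchanges the two conditions. -/
theorem omitsOne_dual_iff_of_rel_add_two {σ : Setoid (Fin n)} {p q r : Fin n}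
    (hq : (q : ℕ) = p + 1) (hr : (r : ℕ) = p + 2) (h : σ p r) :
    OmitsOne (dual σ) {p} ↔ OmitsOne (dual σ) {q} := by
  constructor
  · intro hT
    obtain ⟨s, hs, hd, hT'⟩ := hT.exists_ne_of_singleton
    have := hd p r h
    have e : s = q := by
      simp only [Fin.le_def, Fin.ext_iff, ne_eq] at *
      omega
    exact e ▸ hT'
  · intro hT
    obtain ⟨s, hs, hd, hT'⟩ := hT.exists_ne_of_singleton
    have := hd p r h
    have e : s = p := by
      simp only [Fin.le_def, Fin.ext_iff, ne_eq] at *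
      omega
    exact e ▸ hT'

/-- Because `p` and `r` are related, a partner `s̃` of the last vertex has `s < p`. The class of `s`
then contains some `j > p` outside `headInsert p`, and this pair separates `s̃` from `r̃`. -/
theorem not_omitsOne_dual_last {σ : Setoid (Fin n)} {p r : Fin n} (hp : (p : ℕ) = n - 3)
    (hr : (r : ℕ) = n - 1) (hσ : σ p r) (h : OmitsOne σ (headInsert p)) :
    ¬ OmitsOne (dual σ) {r} := by
  intro hT
  obtain ⟨s, hs, hd, -⟩ := hT.exists_ne_of_singleton
  obtain ⟨j, ⟨hj, hjp⟩, -⟩ := h s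
  have h₁ := hd p r hσ
  have h₂ := hd s j hj
  rw [mem_headInsert] at hjp
  simp only [Fin.le_def, Fin.ext_iff, ne_eq] at *
  omega

/-- For `n - 3 ≤ p`, the set of all `ī` except for the last three, together with `p̄` and `q̃`. -/
def tailSet (hn : 3 ≤ n) (p q : Fin n) (hp : n - 3 ≤ p) : Set.powersetCard (Fin (2 * n)) (n - 1) :=
  ⟨positions (headInsert p) {q}, by
    rw [Set.powersetCard.mem_iff, card_positions, card_headInsert hn hp, Finset.card_singleton]
    omega⟩

open Classical in
theorem ιMultiDual_tailSet_concordanceVector (hn : 3 ≤ n) (σ : Setoid (Fin n)) (p q : Fin n)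
    (hp : n - 3 ≤ p) :
    exteriorPower.ιMultiDual ℝ (n - 1) (Pi.basisFun ℝ (Fin (2 * n))) (tailSet hn p q hp)
      (concordanceVector σ) =
      if OmitsOne σ (headInsert p) ∧ OmitsOne (dual σ) {q} then 1 else 0 := by
  rw [ιMultiDual_concordanceVector]
  refine if_congr ?_ rfl rfl
  rw [tailSet, isConcordant_positions_iff, card_headInsert hn hp, Finset.card_singleton]
  exact and_iff_right (by omega)

/-- The coordinate functional at `tailSet`. -/
def tailCoord (hn : 3 ≤ n) (p q : Fin n) (hp : n - 3 ≤ p) :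
    ⋀[ℝ]^(n - 1) (Fin (2 * n) → ℝ) →ₗ[ℝ] ℝ :=
  exteriorPower.ιMultiDual ℝ (n - 1) (Pi.basisFun ℝ (Fin (2 * n))) (tailSet hn p q hp)

/-- A linear functional that vanishes on the concordance space but not on `⋀^{n-1} V`. -/
def tailFunctional (hn : 3 ≤ n) : ⋀[ℝ]^(n - 1) (Fin (2 * n) → ℝ) →ₗ[ℝ] ℝ :=
  let D := tailCoord hn
  let p₀ : Fin n := ⟨n - 3, by omega⟩
  let p₁ : Fin n := ⟨n - 2, by omega⟩
  let p₂ : Fin n := ⟨n - 1, by omega⟩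
  -- The pairs `p ≤ q` among the last three indices, each with sign `(-1)^{p+q}`.
  D p₀ p₀ (by simp [p₀]) - D p₀ p₁ (by simp [p₀]) + D p₀ p₂ (by simp [p₀])
    + D p₁ p₁ (by simp only [p₁]; omega) - D p₁ p₂ (by simp only [p₁]; omega)
    + D p₂ p₂ (by simp only [p₂]; omega)

-- Either no `B` holds or exactly two do. With `B₀, B₁` the sum telescopes to the indicator of `T₀`,
-- with `B₁, B₂` to that of `T₁`, and with `B₀, B₂` it is `T₀ - T₁ + 2 T₂`; each is zero by
-- `h₄`–`h₇`.
open Classical in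
theorem alternating_indicator_sum_eq_zero {B₀ B₁ B₂ T₀ T₁ T₂ : Prop} (h₀ : B₀ → B₁ ∨ B₂)
    (h₁ : B₁ → B₀ ∨ B₂) (h₂ : B₂ → B₀ ∨ B₁) (h₃ : B₀ → B₁ → ¬ B₂) (h₄ : B₀ → B₁ → ¬ T₀)
    (h₅ : B₁ → B₂ → ¬ T₁) (h₆ : B₀ → B₂ → (T₀ ↔ T₁)) (h₇ : B₀ → B₂ → ¬ T₂) :
    (if B₀ ∧ T₀ then (1 : ℝ) else 0) - (if B₀ ∧ T₁ then 1 else 0) + (if B₀ ∧ T₂ then 1 else 0)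
      + (if B₁ ∧ T₁ then 1 else 0) - (if B₁ ∧ T₂ then 1 else 0)
      + (if B₂ ∧ T₂ then 1 else 0) = 0 := by
  by_cases b₀ : B₀ <;> by_cases b₁ : B₁ <;> by_cases b₂ : B₂ <;> simp_all

theorem tailFunctional_concordanceVector (hn : 3 ≤ n) (σ : Setoid (Fin n)) :
    tailFunctional hn (concordanceVector σ) = 0 := by
  simp only [tailFunctional, tailCoord, LinearMap.add_apply, LinearMap.sub_apply,
    ιMultiDual_tailSet_concordanceVector]
  have b₀ : n - 3 ≤ ((⟨n - 3, by omega⟩ : Fin n) : ℕ) := le_rfl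
  have b₁ : n - 3 ≤ ((⟨n - 2, by omega⟩ : Fin n) : ℕ) := by simp only; omega
  have b₂ : n - 3 ≤ ((⟨n - 1, by omega⟩ : Fin n) : ℕ) := by simp only; omega
  have n₀₁ : (⟨n - 3, by omega⟩ : Fin n) ≠ ⟨n - 2, by omega⟩ := by simp [Fin.ext_iff]; omega
  have n₀₂ : (⟨n - 3, by omega⟩ : Fin n) ≠ ⟨n - 1, by omega⟩ := by simp [Fin.ext_iff]; omega
  have n₁₂ : (⟨n - 2, by omega⟩ : Fin n) ≠ ⟨n - 1, by omega⟩ := by simp [Fin.ext_iff]; omega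
  have cases : ∀ r : Fin n, n - 3 ≤ r → r = ⟨n - 3, by omega⟩ ∨ r = ⟨n - 2, by omega⟩ ∨
      r = ⟨n - 1, by omega⟩ := by
    intro r hr
    simp only [Fin.ext_iff]
    omega
  refine alternating_indicator_sum_eq_zero ?_ ?_ ?_ ?_ ?_ ?_ ?_ ?_
  · intro h
    obtain ⟨r, hr, hne, -, hB⟩ := h.exists_ne_of_headInsert b₀
    rcases cases r hr with rfl | rfl | rfl
    exacts [absurd rfl hne, Or.inl hB, Or.inr hB]
  · intro h
    obtain ⟨r, hr, hne, -, hB⟩ := h.exists_ne_of_headInsert b₁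
    rcases cases r hr with rfl | rfl | rfl
    exacts [Or.inl hB, absurd rfl hne, Or.inr hB]
  · intro h
    obtain ⟨r, hr, hne, -, hB⟩ := h.exists_ne_of_headInsert b₂
    rcases cases r hr with rfl | rfl | rfl
    exacts [Or.inl hB, Or.inr hB, absurd rfl hne]
  · exact fun h h' h'' => h''.not_rel_of_headInsert b₀ b₁ n₀₂ n₁₂ n₀₁
      (h.rel_of_headInsert b₀ n₀₁ h')
  · exact fun h h' => not_omitsOne_dual_of_rel_succ (by simp only; omega)
      (h.rel_of_headInsert b₀ n₀₁ h')
  · exact fun h h' => not_omitsOne_dual_of_rel_succ (by simp only; omega)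
      (h.rel_of_headInsert b₁ n₁₂ h')
  · exact fun h h' => omitsOne_dual_iff_of_rel_add_two (by simp only; omega)
      (by simp only; omega) (h.rel_of_headInsert b₀ n₀₂ h')
  · exact fun h h' => not_omitsOne_dual_last rfl rfl (h.rel_of_headInsert b₀ n₀₂ h') h

/-- The indices of the basis vectors `v_1, v_3, …, v_{2n-7}, v_{2n-3}, v_{2n-2}` (counted from
`1`). -/
def tailIndex (hn : 3 ≤ n) (t : Fin (n - 1)) : Fin (2 * n - 2) :=
  ⟨if (t : ℕ) < n - 3 then 2 * t else if (t : ℕ) = n - 3 then 2 * n - 4 else 2 * n - 3, by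
    split_ifs <;> omega⟩

theorem tailSet_orderEmb (hn : 3 ≤ n) {p q : Fin n} (hp : n - 3 ≤ p) (hpq : p ≤ q)
    (t : Fin (n - 1)) :
    (Set.powersetCard.ofFinEmbEquiv.symm (tailSet hn p q hp) t : ℕ) =
      if (t : ℕ) < n - 3 then 2 * (t : ℕ) else if (t : ℕ) = n - 3 then 2 * (p : ℕ)
        else 2 * (q : ℕ) + 1 := by
  let f : Fin (n - 1) → Fin (2 * n) := fun t =>
    if (t : ℕ) < n - 3 then bar ⟨t, by omega⟩ else if (t : ℕ) = n - 3 then bar p else tilde q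
  have hf : ∀ t, (f t : ℕ) = if (t : ℕ) < n - 3 then 2 * (t : ℕ) else
      if (t : ℕ) = n - 3 then 2 * (p : ℕ) else 2 * (q : ℕ) + 1 := by
    intro t
    simp only [f]
    split_ifs <;> simp [bar_val, tilde_val]
  rw [← hf, Set.powersetCard.ofFinEmbEquiv_symm_apply]
  refine congrArg Fin.val (congrFun (Finset.orderEmbOfFin_unique _ (fun t => ?_) ?_) t).symm
  · simp only [f, tailSet]
    split_ifs with h₁ h₂
    · rw [bar_mem_positions, mem_headInsert]; exact Or.inr h₁
    · rw [bar_mem_positions, mem_headInsert]; exact Or.inl rfl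
    · rw [tilde_mem_positions, Finset.mem_singleton]
  · intro s t hst
    rw [Fin.lt_def] at hst ⊢
    rw [Fin.le_def] at hpq
    rw [hf, hf]
    split_ifs <;> omega

/-- The coordinate is a determinant, upper triangular since each `v_i` starts at `e_i`. Its diagonal
entries are `1`, except that the one for `v_{2n-3}`, equal to the sum of the last two `ē`, is `0`
when `p = n - 3`. -/
theorem tailCoord_ιMulti (hn : 3 ≤ n) {p q : Fin n} (hp : n - 3 ≤ p) (hpq : p ≤ q) :
    tailCoord hn p q hp (exteriorPower.ιMulti ℝ (n - 1) fun t => vVec n (tailIndex hn t)) =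
      if n - 2 ≤ p then 1 else 0 := by
  rw [tailCoord, exteriorPower.ιMultiDual_apply_ιMulti]
  have hentry : ∀ i j : Fin (n - 1),
      (Pi.basisFun ℝ (Fin (2 * n))).coord
        (Set.powersetCard.ofFinEmbEquiv.symm (tailSet hn p q hp) j) (vVec n (tailIndex hn i)) =
      vVec n (tailIndex hn i) (Set.powersetCard.ofFinEmbEquiv.symm (tailSet hn p q hp) j) := by
    intro i j
    simp
  rw [Fin.le_def] at hpq
  rw [Matrix.det_of_isUpperTriangular]
  · simp only [Matrix.of_apply, hentry]
    split_ifs with h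
    · refine Finset.prod_eq_one fun i _ => ?_
      rw [vVec, if_pos]
      rw [tailSet_orderEmb hn hp (Fin.le_def.mpr hpq)]
      simp only [tailIndex]
      split_ifs <;> omega
    · refine Finset.prod_eq_zero (Finset.mem_univ ⟨n - 3, by omega⟩) ?_
      rw [vVec, if_neg]
      rw [tailSet_orderEmb hn hp (Fin.le_def.mpr hpq)]
      simp only [tailIndex]
      split_ifs <;> omega
  · intro i j hij
    rw [Matrix.of_apply, hentry, vVec, if_neg]
    rw [tailSet_orderEmb hn hp (Fin.le_def.mpr hpq)]
    simp only [tailIndex, id, Fin.lt_def] at *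
    split_ifs <;> omega

theorem tailFunctional_ιMulti (hn : 3 ≤ n) :
    tailFunctional hn (exteriorPower.ιMulti ℝ (n - 1) fun t => vVec n (tailIndex hn t)) = 1 := by
  simp only [tailFunctional, LinearMap.add_apply, LinearMap.sub_apply]
  rw [tailCoord_ιMulti, tailCoord_ιMulti, tailCoord_ιMulti, tailCoord_ιMulti, tailCoord_ιMulti,
    tailCoord_ιMulti]
  · have h₀ : ¬ n - 2 ≤ n - 3 := by omega
    have h₁ : n - 2 ≤ n - 1 := by omega
    simp [h₀, h₁]
  all_goals simp only [Fin.le_def]; omega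

/-- For `n ≥ 3` the concordance space does not contain `⋀^{n-1} V`. -/
theorem not_range_le_concordanceSpace (hn : 3 ≤ n) :
    ¬ LinearMap.range (exteriorPower.map (n - 1) (V n).subtype) ≤ concordanceSpace n := by
  intro h
  have hle : concordanceSpace n ≤ LinearMap.ker (tailFunctional hn) := by
    refine Submodule.span_le.mpr ?_
    rintro w ⟨σ, -, rfl⟩
    exact tailFunctional_concordanceVector hn σ
  have hmem := hle (h ⟨exteriorPower.ιMulti ℝ (n - 1) fun t => vBasis n (tailIndex hn t), rfl⟩)
  rw [exteriorPower.map_apply_ιMulti, LinearMap.mem_ker] at hmem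
  have : ((V n).subtype ∘ fun t => vBasis n (tailIndex hn t)) =
      fun t => vVec n (tailIndex hn t) := funext fun t => coe_vBasis n _
  rw [this, tailFunctional_ιMulti] at hmem
  exact one_ne_zero hmem

end Nonvanishing

/-! ### Proportionality to `Λ` -/

section Proportionality

variable {n : ℕ}

theorem lambdaForm_vBasis (i j : Fin (2 * n - 2)) :
    lambdaForm n (vBasis n i) (vBasis n j) = lambdaMatrix n i j := by
  rw [← LinearMap.BilinForm.toMatrix_apply (vBasis n), lambdaForm,
    LinearMap.BilinForm.toMatrix_toBilin]

theorem convolution_zero {W : Type*} [AddCommGroup W] [Module ℝ W]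
    (h : IsSkewSymmetric (0 : LinearMap.BilinForm ℝ W)) (k : ℕ) : convolution 0 h k = 0 := by
  match k with
  | 0 => rfl
  | 1 => rfl
  | k + 2 =>
    apply exteriorPower.linearMap_ext
    ext x
    change ((convolution 0 h (k + 2) (exteriorPower.ιMulti ℝ (k + 2) x) : ⋀[ℝ]^k W) :
      ExteriorAlgebra ℝ W) = 0
    rw [convolution_ιMulti]
    simp

/-- A skew-symmetric form whose values on the basis vectors are those of a multiple of `Λ` above
the diagonal is that multiple of `Λ`. -/
theorem eq_smul_lambdaForm {ω : LinearMap.BilinForm ℝ (V n)} (hω : IsSkewSymmetric ω) {a : ℝ}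
    (h₁ : ∀ i j : Fin (2 * n - 2), (j : ℕ) = i + 1 →
      ω (vBasis n i) (vBasis n j) = (-1) ^ (i : ℕ) * a)
    (h₂ : ∀ i j : Fin (2 * n - 2), (i : ℕ) + 1 < j → ω (vBasis n i) (vBasis n j) = 0) :
    ω = a • lambdaForm n := by
  refine (vBasis n).ext fun i => (vBasis n).ext fun j => ?_
  rw [LinearMap.smul_apply, LinearMap.smul_apply, lambdaForm_vBasis, lambdaMatrix,
    Matrix.of_apply, smul_eq_mul]
  split_ifs with hij hji
  · rw [h₁ i j hij, mul_comm]
  · rw [hω, h₁ j i hji]; ring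
  · rw [mul_zero]
    rcases lt_trichotomy i j with h | rfl | h
    · exact h₂ i j (by rw [Fin.lt_def] at h; omega)
    · exact hω.self_eq_zero _
    · rw [hω, h₂ j i (by rw [Fin.lt_def] at h; omega), neg_zero]

theorem form_eq_smul_lambdaForm_of_three_le (hn : 3 ≤ n) {ω : LinearMap.BilinForm ℝ (V n)}
    {hω : IsSkewSymmetric ω}
    (hker : concordanceSpace n ≤ (LinearMap.ker (convolution ω hω (n - 1))).map
      (exteriorPower.map (n - 1) (V n).subtype)) :
    ∃ a : ℝ, ω = a • lambdaForm n := by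
  refine ⟨ω (vBasis n ⟨0, by omega⟩) (vBasis n ⟨1, by omega⟩), eq_smul_lambdaForm hω ?_ ?_⟩
  -- Equality of the values of `ω (v_j)` on both neighbours becomes, by skew-symmetry, a change of
  -- sign along the superdiagonal.
  · have step : ∀ i j k : Fin (2 * n - 2), (j : ℕ) = i + 1 → (k : ℕ) = j + 1 →
        ω (vBasis n j) (vBasis n k) = -ω (vBasis n i) (vBasis n j) := by
      intro i j k hij hjk
      rw [← hω]
      rcases Nat.mod_two_eq_zero_or_one j with h | h
      · exact (form_vBasis_even hn hker h hij hjk).symm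
      · exact ((form_vBasis_odd hn hker h).2 i k hij hjk).symm
    have main : ∀ m : ℕ, ∀ i j : Fin (2 * n - 2), (i : ℕ) = m → (j : ℕ) = m + 1 →
        ω (vBasis n i) (vBasis n j) =
          (-1) ^ m * ω (vBasis n ⟨0, by omega⟩) (vBasis n ⟨1, by omega⟩) := by
      intro m
      induction m with
      | zero =>
        intro i j hi hj
        rw [show i = ⟨0, by omega⟩ from Fin.ext hi, show j = ⟨1, by omega⟩ from Fin.ext hj,
          pow_zero, one_mul]
      | succ m ih =>
        intro i j hi hj
        rw [step ⟨m, by omega⟩ i j hi (by omega), ih ⟨m, by omega⟩ i rfl hi, pow_succ]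
        ring
    exact fun i j hij => main i i j rfl hij
  · intro i j hij
    rcases Nat.mod_two_eq_zero_or_one i with hi | hi <;>
    rcases Nat.mod_two_eq_zero_or_one j with hj | hj
    · exact form_vBasis_eq_zero_of_even hn hker hi hj
    · rw [hω, (form_vBasis_odd hn hker hj).1 i hi (by omega) (by omega), neg_zero]
    · exact (form_vBasis_odd hn hker hi).1 j hj (by omega) (by omega)
    · exact form_vBasis_eq_zero_of_odd hn hker hi hj

end Proportionality

end Concordance

end

theorem theorem4p2 (n : ℕ) (hn : 1 ≤ n)
    (ω : LinearMap.BilinForm ℝ (Concordance.V n)) (hω : Concordance.IsSkewSymmetric ω)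
    (hω₂ : n = 2 → ω ≠ 0)
    (hker : (LinearMap.ker (Concordance.convolution ω hω (n - 1))).map
        (exteriorPower.map (n - 1) (Concordance.V n).subtype) =
      Concordance.concordanceSpace n) :
    ∃ a : ℝ, a ≠ 0 ∧ ω = a • Concordance.lambdaForm n := by
  obtain rfl | rfl | hn₃ : n = 1 ∨ n = 2 ∨ 3 ≤ n := by omega
  -- Here `V = 0`, so any nonzero scalar would do.
  · exact ⟨1, one_ne_zero, Concordance.eq_smul_lambdaForm hω
      (fun i => absurd i.2 (by omega)) fun i => absurd i.2 (by omega)⟩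
  · have h : ω = ω (Concordance.vBasis 2 ⟨0, by omega⟩) (Concordance.vBasis 2 ⟨1, by omega⟩) •
        Concordance.lambdaForm 2 := by
      refine Concordance.eq_smul_lambdaForm hω (fun i j hij => ?_) fun i j hij => by omega
      have hi : (i : ℕ) = 0 := by omega
      rw [show i = ⟨0, by omega⟩ from Fin.ext hi,
        show j = ⟨1, by omega⟩ from Fin.ext (by rw [hij, hi]), pow_zero, one_mul]
    exact ⟨_, fun h₀ => hω₂ rfl (by rw [h, h₀, zero_smul]), h⟩
  -- Proportionality needs only that `H` lies in the kernel; the reverse inclusion serves to exclude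
  -- `a = 0`.
  · obtain ⟨a, ha⟩ := Concordance.form_eq_smul_lambdaForm_of_three_le hn₃ hker.ge
    refine ⟨a, ?_, ha⟩
    rintro rfl
    rw [zero_smul] at ha
    subst ha
    apply Concordance.not_range_le_concordanceSpace hn₃
    rw [← hker, Concordance.convolution_zero, LinearMap.ker_zero, Submodule.map_top]
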